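/- Let $k\ge 1$, let $W=(W_t)_{t\ge 0}$ be a Brownian motion in $\mathbb R$, and let $\zeta$ be an exponential random variable with mean $2$, independent of $W$. Let $f\colon\mathbb R\to[0,\infty)$ be a $C^\infty$ function supported in $[-1,1]$ with $\int f(y)\,dy=1$, and for $\epsilon>0$ put $f_\epsilon(y)=\epsilon^{-1}f(y/\epsilon)$. For $x=(x_2,\dots,x_k)\in\mathbb R^{k-1}$ and $t\ge 0$ define the approximate $k$-fold intersection local time $$\alpha_{k,\epsilon}(x;t)=\int\cdots\int_{\{0\le t_1\le\cdots\le t_k\le t\}}\ \prod_{j=2}^{k} f_\epsilon\bigl(W_{t_j}-W_{t_{j-1}}-x_j\bigr)\,dt_1\cdots dt_k$$ (so that $\alpha_{1,\epsilon}(t)=t$). Then almost surely all of the following hold. As $\epsilon\downarrow 0$, $\alpha_{k,\epsilon}(x;\zeta)$ converges locally uniformly in $x$, i.e. uniformly on every compact subset of $\mathbb R^{k-1}$; hence $\alpha_k(x;\zeta):=\lim_{\epsilon\to 0}\alpha_{k,\epsilon}(x;\zeta)$ is continuous in $x\in\mathbb R^{k-1}$. Furthermore, for all bounded Borel measurable functions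 $\Phi\colon\mathbb R^{k-1}\to\mathbb R$, both integrals below converge absolutely and the occupation density formula holds: $$\int_{\mathbb R^{k-1}} \Phi(x_2,\dots,x_k)\,\alpha_k(x_2,\dots,x_k;\zeta)\,dx_2\cdots dx_k=\int\cdots\int_{\{0\le t_1\le\cdots\le t_k\le\zeta\}}\Phi\bigl(W_{t_2}-W_{t_1},\dots,W_{t_k}-W_{t_{k-1}}\bigr)\,dt_1\cdots dt_k .$$ -/

import Mathlib

open MeasureTheory ProbabilityTheory Filter Topology
open scoped NNReal

namespace IntersectionLocalTime

/-- The ordered times `0 ≤ t₁ ≤ ⋯ ≤ t_k ≤ T`, where `k = m + 1` and the time `t_j` is `t (j - 1)`. -/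
def orderedTimes (m : ℕ) (T : ℝ) : Set (Fin (m + 1) → ℝ) :=
  {t | 0 ≤ t 0 ∧ Monotone t ∧ t (Fin.last m) ≤ T}

/-- The vector of increments `(w(t₂) - w(t₁), …, w(t_k) - w(t_{k-1}))`, where `k = m + 1`, of a path
`w` indexed by the nonnegative reals. It is used for nonnegative times only. -/
noncomputable def increments {m : ℕ} (w : ℝ≥0 → ℝ) (t : Fin (m + 1) → ℝ) : Fin m → ℝ :=
  fun j => w (t j.succ).toNNReal - w (t j.castSucc).toNNReal

/-- The rescaled function `f_ε(y) = ε⁻¹ f(y / ε)`. -/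
noncomputable def rescale (f : ℝ → ℝ) (ε y : ℝ) : ℝ := ε⁻¹ * f (y / ε)

/-- The approximate intersection local time `α_{k,ε}(x; T)`, `k = m + 1`, of the path `w`:
the integral over `0 ≤ t₁ ≤ ⋯ ≤ t_k ≤ T` of `∏_{j=2}^k f_ε(w(t_j) - w(t_{j-1}) - x_j)`. -/
noncomputable def approx (f : ℝ → ℝ) {m : ℕ} (w : ℝ≥0 → ℝ) (T ε : ℝ) (x : Fin m → ℝ) : ℝ :=
  ∫ t in orderedTimes m T, ∏ j : Fin m, rescale f ε (increments w t j - x j)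

/-- The intersection local time `α_k(x; T) = lim_{ε → 0⁺} α_{k,ε}(x; T)`, `k = m + 1`, of the
path `w`. -/
noncomputable def limit (f : ℝ → ℝ) {m : ℕ} (w : ℝ≥0 → ℝ) (T : ℝ) (x : Fin m → ℝ) : ℝ :=
  limUnder (𝓝[>] (0 : ℝ)) (fun ε => approx f w T ε x)

end IntersectionLocalTime

/-! The proof separates a probabilistic estimate from a deterministic argument about one path.

Probability. Let `Y` be the difference of the times spent before `t` in two neighbouring intervals
of length `h`. By the Markov property its moments satisfy a recursion against the heat kernel
(`integral_occupation_pow_eq`). The integrand changes sign between the two intervals, so each pair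
of orders gains `h ^ (5/2)` (`momentFun_even_bound`), which gives `E Y ^ 20 ≤ c h ^ 25`. Summing
over a grid of times and dyadic intervals yields almost surely, for all `t ≤ T` at once, a
difference of at most `C (ρ / 2) ^ n` at order `n`, with `ρ = 19/20`
(`ae_forall_exists_dyadic_bound`).

One path. Such a bound makes the dyadic averages of the occupation measure converge uniformly, so
the occupation measure of every time interval has a continuous density, uniformly small on short
intervals (`exists_continuous_density_of_dyadic`). Cut `[0, T)` into short pieces. On a box of
pieces the occupation measure of `(w(t₁), …, w(t_k))` is a product and has a continuous density. The
ordered times contain the boxes with strictly increasing indices and are covered by those with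
nondecreasing indices. The two sums of densities differ only by terms with a repeated neighbouring
index, which are uniformly small. The squeezed measure therefore has a continuous density
(`exists_continuous_density_ordered`).

Passing to increments is a linear map of determinant one followed by integrating out the first
coordinate, which leaves a continuous compactly supported density `G`. The approximations are
mollifications of `G`, so they converge uniformly to `G`, and the occupation density formula says
that `G` is the density of the image measure (`limit_of_density`). Since `T` is arbitrary for each
path, `T = ζ` may be inserted. -/

/-! ### Continuous densities from dyadic masses -/

/-- The dyadic interval `[k / 2 ^ n, (k + 1) / 2 ^ n)`. -/
def dyadicIco (n : ℕ) (k : ℤ) : Set ℝ := Set.Ico (k / 2 ^ n : ℝ) ((k + 1) / 2 ^ n : ℝ)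

lemma mem_dyadicIco_iff {n : ℕ} {k : ℤ} {x : ℝ} : x ∈ dyadicIco n k ↔ ⌊x * 2 ^ n⌋ = k := by
  rw [dyadicIco, Set.mem_Ico, Int.floor_eq_iff, div_le_iff₀ (by positivity),
    lt_div_iff₀ (by positivity)]

lemma measurableSet_dyadicIco (n : ℕ) (k : ℤ) : MeasurableSet (dyadicIco n k) :=
  measurableSet_Ico

lemma dyadicIco_disjoint {n : ℕ} {k l : ℤ} (h : k ≠ l) :
    Disjoint (dyadicIco n k) (dyadicIco n l) := by
  rw [Set.disjoint_left]
  intro x hx hy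
  rw [mem_dyadicIco_iff] at hx hy
  exact h (hx.symm.trans hy)

lemma dyadicIco_succ (n : ℕ) (k : ℤ) :
    dyadicIco n k = dyadicIco (n + 1) (2 * k) ∪ dyadicIco (n + 1) (2 * k + 1) := by
  ext x
  rw [Set.mem_union, dyadicIco, dyadicIco, dyadicIco]
  have h1 : ((k : ℝ) / 2 ^ n) = ((2 * k : ℤ) : ℝ) / 2 ^ (n + 1) := by
    push_cast; field_simp; ring
  have h2 : ((k + 1 : ℝ) / 2 ^ n) = (((2 * k + 1 : ℤ) : ℝ) + 1) / 2 ^ (n + 1) := by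
    push_cast; field_simp; ring
  have h3 : (((2 * k + 1 : ℤ) : ℝ)) / 2 ^ (n + 1) = (((2 * k : ℤ) : ℝ) + 1) / 2 ^ (n + 1) := by
    push_cast; ring
  have h4 : ((2 * k : ℤ) : ℝ) / 2 ^ (n + 1) ≤ (((2 * k : ℤ) : ℝ) + 1) / 2 ^ (n + 1) := by
    gcongr; linarith
  have h5 : (((2 * k : ℤ) : ℝ) + 1) / 2 ^ (n + 1) ≤
      (((2 * k + 1 : ℤ) : ℝ) + 1) / 2 ^ (n + 1) := by
    gcongr; linarith
  rw [h1, h2, h3]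
  rw [← Set.mem_union, Set.Ico_union_Ico_eq_Ico h4 h5]

lemma volume_real_dyadicIco (n : ℕ) (k : ℤ) : volume.real (dyadicIco n k) = (1 / 2 : ℝ) ^ n := by
  rw [dyadicIco, Real.volume_real_Ico_of_le]
  · rw [← sub_div, add_sub_cancel_left, one_div_pow]
  · gcongr; linarith

/-- Two measures agree if they agree and are finite on dyadic intervals. -/
lemma ext_of_dyadicIco {μ ν : Measure ℝ} [IsLocallyFiniteMeasure μ]
    (h : ∀ n k, μ (dyadicIco n k) = ν (dyadicIco n k)) : μ = ν := by
  set D : Set ℝ := {x | ∃ (n : ℕ) (k : ℤ), x = k / 2 ^ n} with hD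
  have hmono : ∀ (n d : ℕ) (k : ℤ), (k / 2 ^ n : ℝ) = ((k * 2 ^ d : ℤ) : ℝ) / 2 ^ (n + d) := by
    intro n d k
    push_cast; field_simp; ring
  have hIco : ∀ (n : ℕ) (k : ℤ) (j : ℕ), μ (Set.Ico (k / 2 ^ n : ℝ) ((k + j) / 2 ^ n : ℝ)) =
      ν (Set.Ico (k / 2 ^ n : ℝ) ((k + j) / 2 ^ n : ℝ)) := by
    intro n k j
    induction j with
    | zero => simp
    | succ j ih =>
      have e : Set.Ico (k / 2 ^ n : ℝ) ((k + (j + 1 : ℕ)) / 2 ^ n : ℝ) =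
          Set.Ico (k / 2 ^ n : ℝ) ((k + j) / 2 ^ n : ℝ) ∪ dyadicIco n (k + j) := by
        rw [dyadicIco]
        push_cast
        rw [Set.Ico_union_Ico_eq_Ico (div_le_div_of_nonneg_right (by simp) (by positivity))
          (div_le_div_of_nonneg_right (by linarith) (by positivity)), add_assoc]
      have hd : Disjoint (Set.Ico (k / 2 ^ n : ℝ) ((k + j) / 2 ^ n : ℝ)) (dyadicIco n (k + j)) := by
        rw [Set.disjoint_left]
        intro x hx hy
        rw [dyadicIco] at hy
        have := hy.1
        push_cast at this
        linarith [hx.2]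
      rw [e, measure_union hd (measurableSet_dyadicIco _ _),
        measure_union hd (measurableSet_dyadicIco _ _), ih, h]
  have hD' : Dense D := by
    refine dense_of_exists_between fun {a b} hab => ?_
    obtain ⟨n, hn⟩ := exists_pow_lt_of_lt_one (sub_pos.2 hab) (by norm_num : (1 / 2 : ℝ) < 1)
    have hp : (0 : ℝ) < 2 ^ n := by positivity
    refine ⟨((⌊a * 2 ^ n⌋ + 1 : ℤ) : ℝ) / 2 ^ n, ⟨n, _, rfl⟩, ?_, ?_⟩
    · rw [lt_div_iff₀ hp]
      push_cast
      exact Int.lt_floor_add_one _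
    · rw [div_lt_iff₀ hp]
      push_cast
      have h1 := Int.floor_le (a * 2 ^ n)
      have : (1 / 2 : ℝ) ^ n * 2 ^ n = 1 := by rw [← mul_pow]; norm_num
      nlinarith
  refine Measure.ext_of_generateFrom_of_iUnion _ (fun j : ℕ => Set.Ico (-(j + 1) : ℝ) (j + 1))
    ((BorelSpace.measurable_eq).trans (hD'.borel_eq_generateFrom_Ico_mem)) (isPiSystem_Ico_mem D D)
    ?_ ?_ ?_ ?_
  · refine Set.iUnion_eq_univ_iff.2 fun x => ?_
    obtain ⟨j, hj⟩ := exists_nat_gt |x|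
    have := abs_lt.1 hj
    exact ⟨j, by constructor <;> linarith [this.1, this.2]⟩
  · intro j
    refine ⟨_, ⟨0, -(j + 1), by push_cast; simp⟩, _, ⟨0, (j + 1), by push_cast; simp⟩, by linarith,
      rfl⟩
  · intro j
    exact measure_Ico_lt_top.ne
  · rintro _ ⟨l, ⟨n, k, rfl⟩, u, ⟨m, i, rfl⟩, hlt, rfl⟩
    -- Over the common denominator `2 ^ (n + m)` the interval is a finite union of dyadic intervals
    -- of one order.
    have hlt' := hlt
    rw [hmono n m k, hmono m n i, add_comm m n, div_lt_div_iff_of_pos_right (by positivity)] at hlt'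
    have hlt'' : k * 2 ^ m < i * 2 ^ n := by exact_mod_cast hlt'
    rw [hmono n m k, hmono m n i, add_comm m n]
    have := hIco (n + m) (k * 2 ^ m) (i * 2 ^ n - k * 2 ^ m).toNat
    have e : (((i * 2 ^ n - k * 2 ^ m).toNat : ℕ) : ℝ) =
        ((i * 2 ^ n : ℤ) : ℝ) - ((k * 2 ^ m : ℤ) : ℝ) := by
      rw [← Int.cast_sub, ← Int.cast_natCast, Int.toNat_of_nonneg (by linarith)]
    rw [e, add_sub_cancel] at this
    exact this

section DyadicDensity

variable {μ : Measure ℝ} [IsFiniteMeasure μ] {C ρ : ℝ}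

/-- The average density of `μ` on the dyadic interval of order `n` containing `x`. -/
noncomputable def dyadicDensity (μ : Measure ℝ) (n : ℕ) (x : ℝ) : ℝ :=
  2 ^ n * μ.real (dyadicIco n ⌊x * 2 ^ n⌋)

lemma measurable_dyadicDensity (μ : Measure ℝ) (n : ℕ) : Measurable (dyadicDensity μ n) := by
  have : Measurable fun k : ℤ => 2 ^ n * μ.real (dyadicIco n k) := measurable_of_countable _
  exact this.comp (Int.measurable_floor.comp (by fun_prop))

lemma dyadicDensity_nonneg (μ : Measure ℝ) (n : ℕ) (x : ℝ) : 0 ≤ dyadicDensity μ n x := by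
  unfold dyadicDensity; positivity

lemma dyadicDensity_le (μ : Measure ℝ) [IsFiniteMeasure μ] (n : ℕ) (x : ℝ) :
    dyadicDensity μ n x ≤ 2 ^ n * μ.real Set.univ := by
  unfold dyadicDensity
  gcongr
  · exact measure_ne_top _ _
  · exact Set.subset_univ _

lemma dyadicDensity_of_mem {μ : Measure ℝ} {n : ℕ} {k : ℤ} {x : ℝ} (h : x ∈ dyadicIco n k) :
    dyadicDensity μ n x = 2 ^ n * μ.real (dyadicIco n k) := by
  rw [mem_dyadicIco_iff] at h
  rw [dyadicDensity, h]

lemma measureReal_dyadicIco_succ (n : ℕ) (k : ℤ) : μ.real (dyadicIco n k) =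
    μ.real (dyadicIco (n + 1) (2 * k)) + μ.real (dyadicIco (n + 1) (2 * k + 1)) := by
  rw [dyadicIco_succ, measureReal_union (dyadicIco_disjoint (by lia)) (measurableSet_dyadicIco _ _)]

lemma integrableOn_dyadicDensity (n N : ℕ) (k : ℤ) :
    IntegrableOn (dyadicDensity μ n) (dyadicIco N k) := by
  refine Measure.integrableOn_of_bounded (M := 2 ^ n * μ.real Set.univ) measure_Ico_lt_top.ne
    (measurable_dyadicDensity μ n).aestronglyMeasurable ?_
  refine ae_of_all _ fun x => ?_
  rw [Real.norm_of_nonneg (dyadicDensity_nonneg μ n x)]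
  exact dyadicDensity_le μ n x

lemma setIntegral_dyadicDensity (d N : ℕ) (k : ℤ) :
    ∫ x in dyadicIco N k, dyadicDensity μ (N + d) x = μ.real (dyadicIco N k) := by
  induction d generalizing N k with
  | zero =>
    rw [add_zero]
    rw [setIntegral_congr_fun (measurableSet_dyadicIco N k) (fun x hx => dyadicDensity_of_mem hx)]
    rw [setIntegral_const, volume_real_dyadicIco, smul_eq_mul, ← mul_assoc, ← mul_pow]
    norm_num
  | succ d ih =>
    have e : N + (d + 1) = (N + 1) + d := by ring
    rw [dyadicIco_succ, setIntegral_union (dyadicIco_disjoint (by lia))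
      (measurableSet_dyadicIco _ _) (integrableOn_dyadicDensity _ _ _)
      (integrableOn_dyadicDensity _ _ _), e, ih, ih, ← dyadicIco_succ,
      ← measureReal_dyadicIco_succ]

/-- The density on a dyadic interval is the mean of the densities on its halves, so it differs from
either by `2 ^ n` times the difference of the two masses. The hypothesis is applied to the halves,
which are neighbours of order `n + 1`. -/
lemma dist_dyadicDensity_succ_le (hρ : 0 < ρ) (hρ1 : ρ < 1)
    (h : ∀ (n : ℕ) (k : ℤ), |μ.real (dyadicIco n k) - μ.real (dyadicIco n (k + 1))| ≤
      C * (ρ / 2) ^ n) (n : ℕ) (x : ℝ) :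
    dist (dyadicDensity μ n x) (dyadicDensity μ (n + 1) x) ≤ C * ρ ^ n := by
  obtain ⟨k, hk⟩ : ∃ k, x ∈ dyadicIco n k := ⟨_, mem_dyadicIco_iff.2 rfl⟩
  have hC : 0 ≤ C := by simpa using (abs_nonneg _).trans (h 0 0)
  have h1 := h (n + 1) (2 * k)
  have e : (2 : ℝ) ^ n * (C * (ρ / 2) ^ (n + 1)) = C * ρ ^ n * (ρ / 2) := by
    rw [div_pow]; field_simp; ring
  have key : 2 ^ n * |μ.real (dyadicIco (n + 1) (2 * k)) - μ.real (dyadicIco (n + 1) (2 * k + 1))|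
      ≤ C * ρ ^ n := by
    calc _ ≤ 2 ^ n * (C * (ρ / 2) ^ (n + 1)) := by gcongr
      _ = C * ρ ^ n * (ρ / 2) := e
      _ ≤ _ := mul_le_of_le_one_right (by positivity) (by linarith)
  rw [dyadicDensity_of_mem hk, measureReal_dyadicIco_succ]
  rw [dyadicIco_succ] at hk
  rcases hk with hk | hk
  · rw [dyadicDensity_of_mem hk, Real.dist_eq, ← abs_neg]
    convert key using 1
    rw [← abs_of_pos (show (0 : ℝ) < 2 ^ n by positivity), ← abs_mul,
      abs_of_pos (show (0 : ℝ) < 2 ^ n by positivity)]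
    congr 1; ring
  · rw [dyadicDensity_of_mem hk, Real.dist_eq]
    convert key using 1
    rw [← abs_of_pos (show (0 : ℝ) < 2 ^ n by positivity), ← abs_mul,
      abs_of_pos (show (0 : ℝ) < 2 ^ n by positivity)]
    congr 1; ring

/-- Points at distance at most `2⁻ⁿ` lie in the same or in neighbouring intervals of order `n`. -/
lemma abs_dyadicDensity_sub_le {μ : Measure ℝ} (hC : 0 ≤ C) (hρ : 0 < ρ)
    (h : ∀ (n : ℕ) (k : ℤ), |μ.real (dyadicIco n k) - μ.real (dyadicIco n (k + 1))| ≤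
      C * (ρ / 2) ^ n) (n : ℕ) (x y : ℝ) (hxy : |x - y| ≤ (1 / 2) ^ n) :
    |dyadicDensity μ n x - dyadicDensity μ n y| ≤ C * ρ ^ n := by
  wlog hle : x ≤ y generalizing x y
  · rw [abs_sub_comm]
    exact this y x (by rwa [abs_sub_comm]) (by linarith)
  have hp : (1 / 2 : ℝ) ^ n * 2 ^ n = 1 := by rw [← mul_pow]; norm_num
  have h0 : (0 : ℝ) < 2 ^ n := by positivity
  rw [abs_of_nonpos (by linarith)] at hxy
  have h1 : ⌊x * 2 ^ n⌋ ≤ ⌊y * 2 ^ n⌋ := Int.floor_mono (by gcongr)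
  have h2 : ⌊y * 2 ^ n⌋ ≤ ⌊x * 2 ^ n⌋ + 1 := by
    rw [← Int.floor_add_one]
    refine Int.floor_mono ?_
    nlinarith
  have h3 : ⌊y * 2 ^ n⌋ = ⌊x * 2 ^ n⌋ ∨ ⌊y * 2 ^ n⌋ = ⌊x * 2 ^ n⌋ + 1 := by lia
  unfold dyadicDensity
  rcases h3 with h3 | h3
  · rw [h3, sub_self, abs_zero]; positivity
  · rw [h3, ← mul_sub, abs_mul, abs_of_pos h0]
    calc _ ≤ 2 ^ n * (C * (ρ / 2) ^ n) := by gcongr; exact h _ _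
      _ = _ := by rw [div_pow]; field_simp

/-- A finite measure whose masses on neighbouring dyadic intervals are close has a continuous
density, with an explicit bound. -/
theorem exists_continuous_density_of_dyadic (hρ : 0 < ρ) (hρ1 : ρ < 1)
    (h : ∀ (n : ℕ) (k : ℤ), |μ.real (dyadicIco n k) - μ.real (dyadicIco n (k + 1))| ≤
      C * (ρ / 2) ^ n) :
    ∃ q : ℝ → ℝ, Continuous q ∧ (∀ x, 0 ≤ q x) ∧
      (∀ n x, q x ≤ 2 ^ n * μ.real Set.univ + C * ρ ^ n / (1 - ρ)) ∧
      μ = volume.withDensity (fun x => ENNReal.ofReal (q x)) := by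
  have hC : 0 ≤ C := by simpa using (abs_nonneg _).trans (h 0 0)
  have hc : ∀ x, ∃ a, Tendsto (fun n => dyadicDensity μ n x) atTop (𝓝 a) := fun x =>
    cauchySeq_tendsto_of_complete (cauchySeq_of_le_geometric ρ C hρ1
      (fun n => dist_dyadicDensity_succ_le hρ hρ1 h n x))
  choose q hq using hc
  have hb : ∀ n x, |dyadicDensity μ n x - q x| ≤ C * ρ ^ n / (1 - ρ) := fun n x =>
    dist_le_of_le_geometric_of_tendsto ρ C hρ1
      (fun n => dist_dyadicDensity_succ_le hρ hρ1 h n x) (hq x) n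
  have hlim : ∀ D : ℝ, Tendsto (fun n : ℕ => D * ρ ^ n) atTop (𝓝 0) := fun D => by
    simpa using (tendsto_pow_atTop_nhds_zero_of_lt_one hρ.le hρ1).const_mul D
  have hcont : Continuous q := by
    rw [Metric.continuous_iff]
    intro x ε hε
    -- One `C` pays for the step to a neighbouring interval, and two geometric tails `C / (1 - ρ)`
    -- for replacing `q` by the dyadic density at both points.
    obtain ⟨n, hn⟩ := ((hlim (C + 2 * (C / (1 - ρ)))).eventually (gt_mem_nhds hε)).exists
    refine ⟨(1 / 2) ^ n, by positivity, fun y hy => ?_⟩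
    rw [Real.dist_eq] at hy ⊢
    have h1 := abs_le.1 (abs_dyadicDensity_sub_le hC hρ h n y x hy.le)
    have h2 := abs_le.1 (hb n x)
    have h3 := abs_le.1 (hb n y)
    have e : (C + 2 * (C / (1 - ρ))) * ρ ^ n = C * ρ ^ n + 2 * (C * ρ ^ n / (1 - ρ)) := by ring
    rw [abs_lt]
    constructor <;> linarith [h1.1, h1.2, h2.1, h2.2, h3.1, h3.2]
  have hq0 : ∀ x, 0 ≤ q x := fun x => ge_of_tendsto' (hq x) fun n => dyadicDensity_nonneg μ n x
  refine ⟨q, hcont, hq0, ?_, ?_⟩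
  · intro n x
    have := abs_le.1 (hb n x)
    linarith [dyadicDensity_le μ n x, this.1]
  refine ext_of_dyadicIco fun N k => ?_
  have hqi : IntegrableOn q (dyadicIco N k) :=
    (hcont.continuousOn.integrableOn_compact isCompact_Icc).mono_set Set.Ico_subset_Icc_self
  -- All finer dyadic densities have the same integral over a fixed dyadic interval, namely its
  -- mass, and uniform convergence carries this to `q`.
  have hint : ∫ x in dyadicIco N k, q x = μ.real (dyadicIco N k) := by
    refine tendsto_nhds_unique (f := fun d => ∫ x in dyadicIco N k, dyadicDensity μ (N + d) x)
      (l := atTop) ?_ (by simp_rw [setIntegral_dyadicDensity]; exact tendsto_const_nhds)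
    rw [tendsto_iff_norm_sub_tendsto_zero]
    refine squeeze_zero (fun _ => norm_nonneg _) (fun d => ?_)
      ((hlim (C / (1 - ρ) * volume.real (dyadicIco N k))).comp (tendsto_add_atTop_nat N))
    rw [← integral_sub (integrableOn_dyadicDensity _ _ _) hqi]
    refine (norm_setIntegral_le_of_norm_le_const (C := C * ρ ^ (N + d) / (1 - ρ))
      (show volume (dyadicIco N k) < ⊤ from measure_Ico_lt_top) fun x _ => hb (N + d) x).trans (le_of_eq ?_)
    simp only [Function.comp, add_comm d N]
    generalize volume.real (dyadicIco N k) = V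
    ring
  rw [withDensity_apply _ (measurableSet_dyadicIco N k), ← ofReal_integral_eq_lintegral_ofReal hqi
    (ae_of_all _ hq0), hint, ofReal_measureReal]

end DyadicDensity

/-! ### Comparison and squeezing of continuous densities -/

lemma withDensity_ofReal_mono {E : Type*} [MeasurableSpace E] {ν : Measure E} {a b : E → ℝ}
    (h : ∀ x, a x ≤ b x) :
    ν.withDensity (fun x => ENNReal.ofReal (a x)) ≤
      ν.withDensity (fun x => ENNReal.ofReal (b x)) :=
  withDensity_mono (ae_of_all _ fun x => ENNReal.ofReal_le_ofReal (h x))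

lemma withDensity_ofReal_add_const_apply {E : Type*} [MeasurableSpace E] {ν : Measure E}
    {a : E → ℝ} (ha0 : ∀ x, 0 ≤ a x)
    {ε : ℝ} (hε : 0 ≤ ε) {s : Set E} (hs : MeasurableSet s) :
    ν.withDensity (fun x => ENNReal.ofReal (a x + ε)) s =
      ν.withDensity (fun x => ENNReal.ofReal (a x)) s + ENNReal.ofReal ε * ν s := by
  rw [withDensity_apply _ hs, withDensity_apply _ hs]
  simp_rw [ENNReal.ofReal_add (ha0 _) hε]
  rw [lintegral_add_right _ measurable_const, setLIntegral_const]

lemma withDensity_ofReal_sum {E : Type*} [MeasurableSpace E] {ν : Measure E} {ι : Type*}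
    (s : Finset ι) {f : ι → E → ℝ}
    (hf : ∀ i, Measurable (f i)) (hf0 : ∀ i x, 0 ≤ f i x) :
    ν.withDensity (fun x => ENNReal.ofReal (∑ i ∈ s, f i x)) =
      ∑ i ∈ s, ν.withDensity (fun x => ENNReal.ofReal (f i x)) := by
  classical
  induction s using Finset.induction_on with
  | empty => simp
  | insert i s hi ih =>
    rw [Finset.sum_insert hi, ← ih, ← withDensity_add_left (hf i).ennreal_ofReal]
    congr 1
    ext x
    rw [Finset.sum_insert hi, ENNReal.ofReal_add (hf0 i x)
      (Finset.sum_nonneg fun j _ => hf0 j x)]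
    rfl

section ContinuousDensity

variable {E : Type*} [TopologicalSpace E] [MeasurableSpace E] [BorelSpace E] {ν : Measure E}
  [SigmaFinite ν] [ν.IsOpenPosMeasure]

/-- Continuous densities are ordered pointwise if the measures are. -/
lemma le_of_withDensity_ofReal_le {a b : E → ℝ} (ha : Continuous a) (hb : Continuous b)
    (hb0 : ∀ x, 0 ≤ b x)
    (h : ν.withDensity (fun x => ENNReal.ofReal (a x)) ≤
      ν.withDensity (fun x => ENNReal.ofReal (b x))) (x : E) : a x ≤ b x := by
  have hae : (fun x => ENNReal.ofReal (a x)) ≤ᵐ[ν] fun x => ENNReal.ofReal (b x) := by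
    refine ae_le_of_forall_setLIntegral_le_of_sigmaFinite ha.measurable.ennreal_ofReal
      fun s hs _ => ?_
    have := h s
    rwa [withDensity_apply _ hs, withDensity_apply _ hs] at this
  have hd := Measure.dense_of_ae hae
  have hc : IsClosed {x | ENNReal.ofReal (a x) ≤ ENNReal.ofReal (b x)} :=
    isClosed_le (ENNReal.continuous_ofReal.comp ha) (ENNReal.continuous_ofReal.comp hb)
  have : x ∈ {x | ENNReal.ofReal (a x) ≤ ENNReal.ofReal (b x)} := by
    rw [← hc.closure_eq]; exact hd x
  exact (ENNReal.ofReal_le_ofReal_iff (hb0 x)).1 this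

/-- A measure which is squeezed between measures with continuous densities that are uniformly
close has a continuous density. -/
theorem exists_continuous_density_of_squeeze {μ : Measure E}
    (h : ∀ ε : ℝ, 0 < ε → ∃ g : E → ℝ, Continuous g ∧ (∀ x, 0 ≤ g x) ∧
      ν.withDensity (fun x => ENNReal.ofReal (g x)) ≤ μ ∧
      μ ≤ ν.withDensity (fun x => ENNReal.ofReal (g x + ε))) :
    ∃ q : E → ℝ, Continuous q ∧ (∀ x, 0 ≤ q x) ∧
      μ = ν.withDensity (fun x => ENNReal.ofReal (q x)) := by
  choose! g hgc hg0 hgl hgu using fun n : ℕ => h ((1 / 2 : ℝ) ^ n) (by positivity)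
  -- Any lower density is below any upper one as measures, hence pointwise by continuity. This makes
  -- the sequence uniformly Cauchy.
  have hle : ∀ m n x, g m x ≤ g n x + (1 / 2) ^ n := fun m n x =>
    le_of_withDensity_ofReal_le (hgc m) ((hgc n).add continuous_const)
      (fun x => add_nonneg (hg0 n x) (by positivity)) ((hgl m).trans (hgu n)) x
  have hd : ∀ n x, dist (g n x) (g (n + 1) x) ≤ 1 * (1 / 2) ^ n := fun n x => by
    have h1 := hle n (n + 1) x
    have h2 := hle (n + 1) n x
    have h3 : (1 / 2 : ℝ) ^ (n + 1) ≤ (1 / 2) ^ n :=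
      pow_le_pow_of_le_one (by norm_num) (by norm_num) (by lia)
    rw [Real.dist_eq, abs_le]
    constructor <;> linarith
  have hc : ∀ x, ∃ a, Tendsto (fun n => g n x) atTop (𝓝 a) := fun x =>
    cauchySeq_tendsto_of_complete (cauchySeq_of_le_geometric (1 / 2) 1 (by norm_num) (hd · x))
  choose q hq using hc
  have hlim : Tendsto (fun n : ℕ => (1 / 2 : ℝ) ^ n) atTop (𝓝 0) :=
    tendsto_pow_atTop_nhds_zero_of_lt_one (by norm_num) (by norm_num)
  have h1 : ∀ n x, q x ≤ g n x + (1 / 2) ^ n := fun n x =>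
    le_of_tendsto' (hq x) fun m => hle m n x
  have h2 : ∀ m x, g m x ≤ q x := fun m x => by
    have := (hq x).add hlim
    rw [add_zero] at this
    exact ge_of_tendsto' this fun n => hle m n x
  have hq0 : ∀ x, 0 ≤ q x := fun x => (hg0 0 x).trans (h2 0 x)
  have hcont : Continuous q := by
    refine TendstoUniformly.continuous (F := g) (p := atTop) ?_ (Frequently.of_forall hgc)
    rw [Metric.tendstoUniformly_iff]
    intro ε hε
    filter_upwards [hlim.eventually (gt_mem_nhds hε)] with n hn x
    rw [Real.dist_eq, abs_lt]
    constructor <;> linarith [h1 n x, h2 n x]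
  refine ⟨q, hcont, hq0, ?_⟩
  -- On sets of finite `ν`-measure the error `2⁻ⁿ ν B` tends to zero.
  refine Measure.ext_of_iUnion_eq_univ (iUnion_spanningSets ν) fun i => ?_
  refine Measure.ext fun s hs => ?_
  rw [Measure.restrict_apply hs, Measure.restrict_apply hs]
  set B := s ∩ spanningSets ν i with hBdef
  have hB : MeasurableSet B := hs.inter (measurableSet_spanningSets ν i)
  have hBf : ν B ≠ ⊤ :=
    ((measure_mono Set.inter_subset_right).trans_lt (measure_spanningSets_lt_top ν i)).ne
  have hlim' : Tendsto (fun n : ℕ => ENNReal.ofReal ((1 / 2 : ℝ) ^ n) * ν B) atTop (𝓝 0) := by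
    have := ENNReal.Tendsto.mul_const (ENNReal.tendsto_ofReal hlim) (Or.inr hBf)
    simpa using this
  apply le_antisymm
  · have := (tendsto_const_nhds (x := ν.withDensity (fun x => ENNReal.ofReal (q x)) B)).add hlim'
    rw [add_zero] at this
    refine ge_of_tendsto' this fun n => ?_
    rw [← withDensity_ofReal_add_const_apply hq0 (by positivity) hB]
    exact (hgu n B).trans (withDensity_ofReal_mono (fun x => by linarith [h2 n x]) B)
  · have := (tendsto_const_nhds (x := μ B)).add hlim'
    rw [add_zero] at this
    refine ge_of_tendsto' this fun n => ?_
    refine (withDensity_ofReal_mono (h1 n) B).trans ?_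
    rw [withDensity_ofReal_add_const_apply (hg0 n) (by positivity) hB]
    gcongr
    exact hgl n

end ContinuousDensity

/-! ### Ordered times: decomposition into boxes -/

/-- A product of finite measures on `ℝ` with densities has the product density. -/
lemma pi_eq_withDensity {ι : Type*} [Fintype ι] {μ : ι → Measure ℝ} [∀ i, IsFiniteMeasure (μ i)]
    {q : ι → ℝ → ℝ} (hq : ∀ i, Measurable (q i)) (hq0 : ∀ i x, 0 ≤ q i x)
    (h : ∀ i, μ i = volume.withDensity (fun x => ENNReal.ofReal (q i x))) :
    Measure.pi μ = volume.withDensity (fun y => ENNReal.ofReal (∏ i, q i (y i))) := by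
  have hint : ∀ i, Integrable (q i) := fun i => by
    refine ⟨(hq i).aestronglyMeasurable, ?_⟩
    rw [hasFiniteIntegral_iff_ofReal (ae_of_all _ (hq0 i)), ← setLIntegral_univ,
      ← withDensity_apply _ MeasurableSet.univ, ← h i]
    exact measure_lt_top _ _
  refine Measure.pi_eq fun s hs => ?_
  rw [withDensity_apply _ (MeasurableSet.univ_pi hs), volume_pi, Measure.restrict_pi_pi,
    ← ofReal_integral_eq_lintegral_ofReal
      (Integrable.fintype_prod (fun i => (hint i).restrict))
      (ae_of_all _ fun y => Finset.prod_nonneg fun i _ => hq0 i (y i)),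
    integral_fintype_prod_eq_prod, ENNReal.ofReal_prod_of_nonneg
      (fun i _ => integral_nonneg fun x => hq0 i x)]
  refine Finset.prod_congr rfl fun i _ => ?_
  rw [h i, withDensity_apply _ (hs i), ofReal_integral_eq_lintegral_ofReal (hint i).restrict
    (ae_of_all _ (hq0 i))]

/-- In a product of sums, the terms where two given consecutive indices agree are small. -/
lemma sum_prod_filter_eq_le {m N : ℕ} {f : Fin N → ℝ → ℝ} {M η : ℝ}
    (hf0 : ∀ i x, 0 ≤ f i x) (hfη : ∀ i x, f i x ≤ η) (hη : 0 ≤ η)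
    (hfM : ∀ x, ∑ i, f i x ≤ M) (y : Fin (m + 1) → ℝ) (j : Fin m) :
    ∑ σ ∈ (Finset.univ : Finset (Fin (m + 1) → Fin N)).filter
      (fun σ => σ j.castSucc = σ j.succ), ∏ l, f (σ l) (y l) ≤ η * M ^ m := by
  have h1 : ∀ σ : Fin (m + 1) → Fin N, ∏ l, f (σ l) (y l) ≤
      η * ∏ l : Fin m, f (σ (j.succ.succAbove l)) (y (j.succ.succAbove l)) := fun σ => by
    rw [Fin.prod_univ_succAbove _ j.succ]
    gcongr
    · exact Finset.prod_nonneg fun l _ => hf0 _ _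
    · exact hfη _ _
  set F : (Fin m → Fin N) → ℝ := fun τ => ∏ l : Fin m, f (τ l) (y (j.succ.succAbove l))
  have hF0 : ∀ τ, 0 ≤ F τ := fun τ => Finset.prod_nonneg fun l _ => hf0 _ _
  calc _ ≤ ∑ σ ∈ (Finset.univ : Finset (Fin (m + 1) → Fin N)).filter
        (fun σ => σ j.castSucc = σ j.succ), η * F (fun l => σ (j.succ.succAbove l)) :=
        Finset.sum_le_sum fun σ _ => h1 σ
    _ = η * ∑ σ ∈ (Finset.univ : Finset (Fin (m + 1) → Fin N)).filter
        (fun σ => σ j.castSucc = σ j.succ), F (fun l => σ (j.succ.succAbove l)) := by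
        rw [Finset.mul_sum]
    _ ≤ η * ∑ τ, F τ := by
        gcongr
        -- An index vector whose coordinates at `j` and `j + 1` agree is recovered after deleting
        -- coordinate `j + 1`, so deletion is injective.
        rw [← Finset.sum_image (f := F) (g := fun (σ : Fin (m + 1) → Fin N) l =>
          σ (j.succ.succAbove l))]
        · exact Finset.sum_le_univ_sum_of_nonneg hF0
        · intro σ hσ σ' hσ' he
          simp only [Finset.coe_filter, Finset.mem_univ, true_and, Set.mem_ofPred_eq] at hσ hσ'
          have hne : ∀ l, l ≠ j.succ → σ l = σ' l := fun l hl => by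
            obtain ⟨k, rfl⟩ := Fin.exists_succAbove_eq hl
            exact congrFun he k
          ext1 l
          by_cases hl : l = j.succ
          · rw [hl, ← hσ, ← hσ']
            exact hne _ (Fin.castSucc_lt_succ (i := j)).ne
          · exact hne l hl
    _ = η * ∏ l : Fin m, ∑ i, f i (y (j.succ.succAbove l)) := by
        rw [Finset.prod_univ_sum, Fintype.piFinset_univ]
    _ ≤ η * M ^ m := by
        gcongr
        calc ∏ l : Fin m, ∑ i, f i (y (j.succ.succAbove l)) ≤ ∏ _l : Fin m, M := Finset.prod_le_prod
              (fun l _ => Finset.sum_nonneg fun i _ => hf0 _ _) (fun l _ => hfM _)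
          _ = M ^ m := by simp

lemma sum_biUnion_le {ι κ : Type*} [DecidableEq ι] (s : Finset κ) (t : κ → Finset ι) {f : ι → ℝ}
    (hf : ∀ i, 0 ≤ f i) : ∑ i ∈ s.biUnion t, f i ≤ ∑ k ∈ s, ∑ i ∈ t k, f i := by
  classical
  induction s using Finset.induction_on with
  | empty => simp
  | insert k s hk ih =>
    rw [Finset.biUnion_insert, Finset.sum_insert hk]
    refine le_trans ?_ (add_le_add_right ih _)
    rw [← Finset.sum_union_inter]
    exact le_add_of_nonneg_right (Finset.sum_nonneg fun i _ => hf i)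

section RestrictSums

variable {α β ι : Type*} [MeasurableSpace α] [MeasurableSpace β] {μ : Measure α} {U : α → β}
  {A : ι → Set α} {O : Set α} {s : Finset ι}

lemma sum_map_restrict_le (hU : Measurable U) (hA : ∀ i, MeasurableSet (A i))
    (hd : Pairwise (Function.onFun Disjoint A)) (hO : ∀ i ∈ s, A i ⊆ O) :
    ∑ i ∈ s, (μ.restrict (A i)).map U ≤ (μ.restrict O).map U := by
  refine Measure.le_iff.2 fun B hB => ?_
  rw [Measure.finsetSum_apply]
  simp_rw [Measure.map_apply hU hB, Measure.restrict_apply (hU hB)]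
  rw [← measure_biUnion_finset]
  · refine measure_mono (Set.iUnion₂_subset fun i hi => ?_)
    exact Set.inter_subset_inter_right _ (hO i hi)
  · intro i _ j _ hij
    exact (hd hij).mono Set.inter_subset_right Set.inter_subset_right
  · exact fun i _ => (hU hB).inter (hA i)

lemma map_restrict_le_sum (hU : Measurable U) (hO : O ⊆ ⋃ i ∈ s, A i) :
    (μ.restrict O).map U ≤ ∑ i ∈ s, (μ.restrict (A i)).map U := by
  refine Measure.le_iff.2 fun B hB => ?_
  rw [Measure.finsetSum_apply]
  simp_rw [Measure.map_apply hU hB, Measure.restrict_apply (hU hB)]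
  refine (measure_mono ?_).trans (measure_biUnion_finset_le _ _)
  intro x hx
  have := hO hx.2
  simp only [Set.mem_iUnion] at this ⊢
  obtain ⟨i, hi, hxi⟩ := this
  exact ⟨i, hi, hx.1, hxi⟩

end RestrictSums

open IntersectionLocalTime in
lemma orderedTimes_ae_eq (m : ℕ) (T : ℝ) :
    orderedTimes m T =ᵐ[volume] {t | 0 ≤ t 0 ∧ Monotone t ∧ t (Fin.last m) < T} := by
  have h : ∀ᵐ t : Fin (m + 1) → ℝ, t (Fin.last m) ≠ T := Measure.ae_eval_ne _ _ _
  filter_upwards [h] with t ht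
  refine propext ⟨fun h => ⟨h.1, h.2.1, lt_of_le_of_ne h.2.2 ht⟩,
    fun h => ⟨h.1, h.2.1, h.2.2.le⟩⟩

open IntersectionLocalTime in
/-- If the occupation measures of short time intervals have small continuous densities, then the
image of Lebesgue measure on the ordered times under the path has a continuous density. -/
theorem exists_continuous_density_ordered {u : ℝ → ℝ} (hu : Measurable u) {T : ℝ} (hT : 0 < T)
    (hloc : ∀ η : ℝ, 0 < η → ∃ δ : ℝ, 0 < δ ∧ ∀ a b, 0 ≤ a → a ≤ b → b ≤ T → b - a ≤ δ →
      ∃ q : ℝ → ℝ, Continuous q ∧ (∀ x, 0 ≤ q x) ∧ (∀ x, q x ≤ η) ∧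
        (volume.restrict (Set.Ico a b)).map u = volume.withDensity (fun x => ENNReal.ofReal (q x)))
    {Q : ℝ → ℝ} (hQc : Continuous Q) (hQ0 : ∀ x, 0 ≤ Q x) {M : ℝ} (hQM : ∀ x, Q x ≤ M)
    (hQ : (volume.restrict (Set.Ico 0 T)).map u =
      volume.withDensity (fun x => ENNReal.ofReal (Q x))) (m : ℕ) :
    ∃ q : (Fin (m + 1) → ℝ) → ℝ, Continuous q ∧ (∀ x, 0 ≤ q x) ∧
      (volume.restrict (orderedTimes m T)).map (fun t j => u (t j)) =
        volume.withDensity (fun y => ENNReal.ofReal (q y)) := by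
  classical
  rw [Measure.restrict_congr_set (orderedTimes_ae_eq m T)]
  have hM : 0 ≤ M := (hQ0 0).trans (hQM 0)
  have hU : Measurable fun (t : Fin (m + 1) → ℝ) j => u (t j) := by fun_prop
  refine exists_continuous_density_of_squeeze fun ε hε => ?_
  -- There are `m` positions for a repeated index, each costing `η * M ^ m`. The `+ 1` in the
  -- witness keeps the denominator positive when `m * M ^ m = 0`.
  obtain ⟨η, hη, hηε⟩ : ∃ η : ℝ, 0 < η ∧ m * (η * M ^ m) ≤ ε := by
    refine ⟨ε / (m * M ^ m + 1), by positivity, ?_⟩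
    rw [div_mul_eq_mul_div, ← mul_div_assoc, div_le_iff₀ (by positivity)]
    nlinarith
  obtain ⟨δ', hδ', hδq⟩ := hloc η hη
  obtain ⟨N, hN⟩ := exists_nat_gt (T / δ')
  have hN0 : (0 : ℝ) < N := lt_trans (by positivity) hN
  obtain ⟨δ, hδ, hδδ, hNδ⟩ : ∃ δ : ℝ, 0 < δ ∧ δ ≤ δ' ∧ N * δ = T :=
    ⟨T / N, by positivity, by
      rw [div_lt_iff₀ hδ'] at hN
      rw [div_le_iff₀ hN0]; linarith, by field_simp⟩
  set J : Fin N → Set ℝ := fun i => Set.Ico (i * δ) ((i + 1) * δ) with hJ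
  have hiN : ∀ i : Fin N, ((i : ℝ) + 1) * δ ≤ T := fun i => by
    rw [← hNδ]
    have : ((i : ℕ) + 1 : ℝ) ≤ N := by exact_mod_cast i.2
    gcongr
  have hqi := fun i : Fin N => hδq (i * δ) ((i + 1) * δ) (by positivity)
    (by gcongr; linarith) (hiN i) (by linarith)
  choose q hqc hq0 hqη hqJ using hqi
  have hmem : ∀ (i : Fin N) x, x ∈ J i → i = ⌊x / δ⌋₊ := fun i x hx => by
    have hx0 : 0 ≤ x := le_trans (by positivity) hx.1
    symm
    rw [Nat.floor_eq_iff (by positivity), le_div_iff₀ hδ, div_lt_iff₀ hδ]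
    exact hx
  have hmem' : ∀ x, 0 ≤ x → x < T → ∃ i : Fin N, x ∈ J i := fun x hx hxT => by
    have h1 := Nat.floor_le (show 0 ≤ x / δ by positivity)
    have h2 := Nat.lt_floor_add_one (x / δ)
    rw [le_div_iff₀ hδ] at h1
    rw [div_lt_iff₀ hδ] at h2
    refine ⟨⟨⌊x / δ⌋₊, ?_⟩, h1, h2⟩
    rw [Nat.floor_lt (by positivity), div_lt_iff₀ hδ, hNδ]
    exact hxT
  have hJd : Pairwise (Function.onFun Disjoint J) := fun i j hij => by
    refine Set.disjoint_left.2 fun x hx hx' => hij ?_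
    exact Fin.ext ((hmem i x hx).trans (hmem j x hx').symm)
  -- The pieces are disjoint parts of `[0, T)`, so their densities add up to at most `Q`. The bound
  -- is therefore independent of the number `N` of pieces.
  have hsum : ∀ x, ∑ i, q i x ≤ M := by
    intro x
    refine le_trans ?_ (hQM x)
    refine le_of_withDensity_ofReal_le (ν := volume) (a := fun x => ∑ i, q i x)
      (continuous_finsetSum _ fun i _ => hqc i) hQc hQ0 ?_ x
    rw [withDensity_ofReal_sum _ (fun i => (hqc i).measurable) hq0, ← hQ]
    simp_rw [← hqJ]
    refine sum_map_restrict_le hu (fun i => measurableSet_Ico) hJd fun i _ => ?_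
    exact Set.Ico_subset_Ico (by positivity) (hiN i)
  set box : (Fin (m + 1) → Fin N) → Set (Fin (m + 1) → ℝ) :=
    fun σ => Set.univ.pi fun j => J (σ j) with hbox
  have hboxm : ∀ σ, MeasurableSet (box σ) := fun σ =>
    MeasurableSet.univ_pi fun j => measurableSet_Ico
  have hboxd : Pairwise (Function.onFun Disjoint box) := fun σ τ hστ => by
    refine Set.disjoint_left.2 fun t ht ht' => hστ (funext fun j => ?_)
    exact Fin.ext ((hmem _ _ (ht j trivial)).trans (hmem _ _ (ht' j trivial)).symm)
  set p : (Fin (m + 1) → Fin N) → (Fin (m + 1) → ℝ) → ℝ := fun σ y => ∏ j, q (σ j) (y j) with hp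
  have hpc : ∀ σ, Continuous (p σ) := fun σ =>
    continuous_finsetProd _ fun j _ => (hqc _).comp (continuous_apply j)
  have hp0 : ∀ σ y, 0 ≤ p σ y := fun σ y => Finset.prod_nonneg fun j _ => hq0 _ _
  have hbp : ∀ σ, (volume.restrict (box σ)).map (fun t j => u (t j)) =
      volume.withDensity (fun y => ENNReal.ofReal (p σ y)) := fun σ => by
    rw [volume_pi, Measure.restrict_pi_pi]
    rw [Measure.pi_map_pi (fun j => hu.aemeasurable)]
    exact pi_eq_withDensity (fun j => (hqc _).measurable) (fun j => hq0 _) (fun j => hqJ _)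
  -- The lower density sums the boxes lying inside the ordered times; a box with a repeated index
  -- may be cut by the diagonal and is charged to `ε`.
  refine ⟨fun y => ∑ σ with StrictMono σ, p σ y, continuous_finsetSum _ fun σ _ => hpc σ,
    fun y => Finset.sum_nonneg fun σ _ => hp0 σ y, ?_, ?_⟩
  · rw [withDensity_ofReal_sum _ (fun σ => (hpc σ).measurable) hp0]
    simp_rw [← hbp]
    refine sum_map_restrict_le hU hboxm hboxd fun σ hσ t ht => ?_
    have hσ' : StrictMono σ := (Finset.mem_filter.1 hσ).2
    refine ⟨le_trans (by positivity) (ht 0 trivial).1, ?_, (ht _ trivial).2.trans_le (hiN _)⟩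
    refine Fin.monotone_iff_le_succ.2 fun j => ?_
    refine (ht j.castSucc trivial).2.le.trans (le_trans ?_ (ht j.succ trivial).1)
    have : ((σ j.castSucc : ℕ) : ℝ) + 1 ≤ (σ j.succ : ℕ) := by
      exact_mod_cast hσ' (Fin.castSucc_lt_succ (i := j))
    gcongr
  · calc _ ≤ ∑ σ with Monotone σ, (volume.restrict (box σ)).map (fun t j => u (t j)) := by
          refine map_restrict_le_sum hU fun t ht => ?_
          have hj : ∀ j, ∃ i, t j ∈ J i := fun j =>
            hmem' _ (ht.1.trans (ht.2.1 (Fin.zero_le j)))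
              ((ht.2.1 (Fin.le_last j)).trans_lt ht.2.2)
          choose σ hσ using hj
          simp only [Set.mem_iUnion]
          refine ⟨σ, Finset.mem_filter.2 ⟨Finset.mem_univ _, fun j k hjk => ?_⟩, fun j _ => hσ j⟩
          rw [Fin.le_def, hmem _ _ (hσ j), hmem _ _ (hσ k)]
          exact Nat.floor_mono (div_le_div_of_nonneg_right (ht.2.1 hjk) hδ.le)
      _ = volume.withDensity (fun y => ENNReal.ofReal (∑ σ with Monotone σ, p σ y)) := by
          rw [withDensity_ofReal_sum _ (fun σ => (hpc σ).measurable) hp0]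
          simp_rw [← hbp]
      _ ≤ _ := by
          refine withDensity_ofReal_mono fun y => ?_
          calc ∑ σ with Monotone σ, p σ y ≤
              ∑ σ ∈ (Finset.univ.filter StrictMono) ∪ Finset.univ.biUnion
                (fun j : Fin m => Finset.univ.filter fun σ : Fin (m + 1) → Fin N =>
                  σ j.castSucc = σ j.succ), p σ y := by
                refine Finset.sum_le_sum_of_subset_of_nonneg ?_ fun σ _ _ => hp0 σ y
                intro σ hσ
                have hσ' : Monotone σ := (Finset.mem_filter.1 hσ).2
                simp only [Finset.mem_union, Finset.mem_filter, Finset.mem_univ, true_and,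
                  Finset.mem_biUnion]
                by_contra! hcon
                refine hcon.1 (Fin.strictMono_iff_lt_succ.2 fun j => ?_)
                exact lt_of_le_of_ne (hσ' (Fin.castSucc_lt_succ (i := j)).le) (hcon.2 j)
            _ ≤ ∑ σ with StrictMono σ, p σ y + ∑ σ ∈ Finset.univ.biUnion
                (fun j : Fin m => Finset.univ.filter fun σ : Fin (m + 1) → Fin N =>
                  σ j.castSucc = σ j.succ), p σ y := by
                rw [← Finset.sum_union_inter]
                exact le_add_of_nonneg_right (Finset.sum_nonneg fun σ _ => hp0 σ y)
            _ ≤ ∑ σ with StrictMono σ, p σ y + ε := by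
                gcongr
                refine (sum_biUnion_le _ _ fun σ => hp0 σ y).trans ?_
                refine (Finset.sum_le_sum fun j _ =>
                  sum_prod_filter_eq_le hq0 hqη hη.le hsum y j).trans ?_
                simpa using hηε

/-! ### From positions to increments -/

/-- A continuous density vanishes on the open null sets of the measure. -/
lemma eq_zero_of_withDensity_apply_eq_zero {E : Type*} [TopologicalSpace E] [MeasurableSpace E]
    [BorelSpace E] {ν : Measure E} [ν.IsOpenPosMeasure] {q : E → ℝ} (hq : Continuous q)
    (hq0 : ∀ x, 0 ≤ q x) {O : Set E} (hO : IsOpen O)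
    (h : ν.withDensity (fun x => ENNReal.ofReal (q x)) O = 0) : ∀ x ∈ O, q x = 0 := by
  rw [withDensity_apply _ hO.measurableSet,
    lintegral_eq_zero_iff hq.measurable.ennreal_ofReal] at h
  have h' : q =ᵐ[ν.restrict O] fun _ => 0 := by
    filter_upwards [h] with x hx
    exact le_antisymm (ENNReal.ofReal_eq_zero.1 hx) (hq0 x)
  exact Measure.eqOn_open_of_ae_eq h' hO hq.continuousOn continuousOn_const

/-- The linear map `y ↦ (y₀, y₁ - y₀, …, y_m - y_{m-1})`. -/
noncomputable def headIncrements (m : ℕ) : (Fin (m + 1) → ℝ) →ₗ[ℝ] (Fin (m + 1) → ℝ) where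
  toFun y := Fin.cons (y 0) fun j => y j.succ - y j.castSucc
  map_add' x y := by
    ext i
    refine Fin.cases ?_ (fun j => ?_) i
    · simp
    · simp; ring
  map_smul' c x := by
    ext i
    refine Fin.cases ?_ (fun j => ?_) i
    · simp
    · simp; ring

lemma headIncrements_apply {m : ℕ} (y : Fin (m + 1) → ℝ) :
    headIncrements m y = Fin.cons (y 0) fun j => y j.succ - y j.castSucc := rfl

lemma det_headIncrements (m : ℕ) : LinearMap.det (headIncrements m) = 1 := by
  rw [← LinearMap.det_toMatrix', Matrix.det_of_isLowerTriangular]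
  · refine Finset.prod_eq_one fun i _ => ?_
    rw [LinearMap.toMatrix'_apply, headIncrements_apply]
    refine Fin.cases ?_ (fun j => ?_) i
    · simp
    · simp [Fin.castSucc_lt_succ.ne]
  · intro i j hij
    rw [OrderDual.toDual_lt_toDual] at hij
    rw [LinearMap.toMatrix'_apply, headIncrements_apply]
    induction i using Fin.cases with
    | zero => simp [hij.ne]
    | succ k =>
      have h1 : k.succ ≠ j := hij.ne
      have h2 : k.castSucc ≠ j := (Fin.castSucc_lt_succ.trans hij).ne
      simp [h1, h2]

lemma measurePreserving_headIncrements (m : ℕ) :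
    MeasurePreserving (fun y : Fin (m + 1) → ℝ =>
      (y 0, fun j : Fin m => y j.succ - y j.castSucc)) := by
  have h1 : MeasurePreserving (headIncrements m) := by
    refine ⟨(LinearMap.continuous_of_finiteDimensional _).measurable, ?_⟩
    rw [Real.map_linearMap_volume_pi_eq_smul_volume_pi (by simp [det_headIncrements]),
      det_headIncrements]
    simp
  have h2 := (volume_preserving_piFinSuccAbove (fun _ : Fin (m + 1) => ℝ) 0).comp h1
  exact h2

/-- The inverse of `y ↦ (y₀, (y₁ - y₀, …, y_m - y_{m-1}))`. -/
noncomputable def partialSums (m : ℕ) (p : ℝ × (Fin m → ℝ)) : Fin (m + 1) → ℝ :=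
  (LinearMap.equivOfDetNeZero (headIncrements m) (by simp [det_headIncrements])).symm
    (Fin.cons p.1 p.2)

lemma continuous_partialSums (m : ℕ) : Continuous (partialSums m) := by
  have h : Continuous fun p : ℝ × (Fin m → ℝ) =>
      (Fin.cons p.1 p.2 : Fin (m + 1) → ℝ) := by fun_prop
  exact (LinearMap.continuous_of_finiteDimensional (LinearEquiv.toLinearMap
    (LinearMap.equivOfDetNeZero (headIncrements m) (by simp [det_headIncrements])).symm)).comp h

lemma headIncrements_partialSums {m : ℕ} (p : ℝ × (Fin m → ℝ)) :
    headIncrements m (partialSums m p) = Fin.cons p.1 p.2 :=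
  LinearEquiv.apply_symm_apply
    (LinearMap.equivOfDetNeZero (headIncrements m) (by simp [det_headIncrements])) _

lemma partialSums_zero {m : ℕ} (p : ℝ × (Fin m → ℝ)) : partialSums m p 0 = p.1 := by
  have := congrFun (headIncrements_partialSums p) 0
  simpa [headIncrements_apply] using this

lemma partialSums_succ_sub {m : ℕ} (p : ℝ × (Fin m → ℝ)) (j : Fin m) :
    partialSums m p j.succ - partialSums m p j.castSucc = p.2 j := by
  have := congrFun (headIncrements_partialSums p) j.succ
  simpa [headIncrements_apply] using this

lemma partialSums_increments {m : ℕ} (y : Fin (m + 1) → ℝ) :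
    partialSums m (y 0, fun j => y j.succ - y j.castSucc) = y :=
  LinearEquiv.symm_apply_apply
    (LinearMap.equivOfDetNeZero (headIncrements m) (by simp [det_headIncrements])) y

/-- The vector of increments of a random vector with continuous compactly supported density has a
continuous compactly supported density. -/
theorem exists_continuous_density_increments {m : ℕ} {q : (Fin (m + 1) → ℝ) → ℝ}
    (hq : Continuous q) (hq0 : ∀ y, 0 ≤ q y) {R : ℝ} (hR : ∀ y, q y ≠ 0 → ∀ j, |y j| ≤ R) :
    ∃ G : (Fin m → ℝ) → ℝ, Continuous G ∧ (∀ x, 0 ≤ G x) ∧ HasCompactSupport G ∧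
      (volume.withDensity (fun y => ENNReal.ofReal (q y))).map
        (fun y (j : Fin m) => y j.succ - y j.castSucc) =
      volume.withDensity (fun x => ENNReal.ofReal (G x)) := by
  have hS := continuous_partialSums m
  have hqS : ∀ x : Fin m → ℝ, Continuous fun a => q (partialSums m (a, x)) := fun x => by fun_prop
  have hzero : ∀ (x : Fin m → ℝ) a, a ∉ Set.Icc (-R) R → q (partialSums m (a, x)) = 0 := by
    intro x a ha
    by_contra h
    have := hR _ h 0
    rw [partialSums_zero] at this
    exact ha (abs_le.1 this)
  have hint : ∀ x : Fin m → ℝ, Integrable fun a => q (partialSums m (a, x)) := fun x =>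
    (hqS x).integrable_of_hasCompactSupport (HasCompactSupport.intro isCompact_Icc (hzero x))
  -- The density of the increments is a marginal: the starting position `a` is integrated out. Its
  -- range is confined to `[-R, R]`, which gives continuity.
  refine ⟨fun x => ∫ a, q (partialSums m (a, x)), ?_, fun x => integral_nonneg fun a => hq0 _,
    ?_, ?_⟩
  · have h := continuous_parametric_integral_of_continuous (μ := (volume : Measure ℝ))
      (f := fun (x : Fin m → ℝ) a => q (partialSums m (a, x))) (s := Set.Icc (-R) R)
      (by simp only [Function.uncurry_def]; fun_prop) isCompact_Icc
    convert h using 2 with x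
    exact (setIntegral_eq_integral_of_forall_compl_eq_zero (hzero x)).symm
  · refine HasCompactSupport.intro (isCompact_closedBall 0 (2 * R)) fun x hx => ?_
    refine integral_eq_zero_of_ae (ae_of_all _ fun a => ?_)
    by_contra h
    have h' := hR _ h
    refine hx ?_
    have hR0 : 0 ≤ R := (abs_nonneg _).trans (h' 0)
    rw [mem_closedBall_zero_iff, pi_norm_le_iff_of_nonneg (by positivity)]
    intro j
    rw [show x j = _ from (partialSums_succ_sub (a, x) j).symm, Real.norm_eq_abs]
    refine (abs_sub _ _).trans ?_
    linarith [h' j.succ, h' j.castSucc]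
  · have hD : Measurable fun (y : Fin (m + 1) → ℝ) (j : Fin m) => y j.succ - y j.castSucc := by
      fun_prop
    refine Measure.ext fun B hB => ?_
    rw [Measure.map_apply hD hB, withDensity_apply _ (hD hB), withDensity_apply _ hB,
      ← lintegral_indicator (hD hB), ← lintegral_indicator hB]
    have h1 : ∀ y : Fin (m + 1) → ℝ,
        ((fun (y : Fin (m + 1) → ℝ) (j : Fin m) => y j.succ - y j.castSucc) ⁻¹' B).indicator
          (fun y => ENNReal.ofReal (q y)) y =
        (fun p : ℝ × (Fin m → ℝ) => B.indicator
          (fun x => ENNReal.ofReal (q (partialSums m (p.1, x)))) p.2)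
          (y 0, fun j : Fin m => y j.succ - y j.castSucc) := by
      intro y
      simp only [Set.indicator]
      rw [partialSums_increments]
      rfl
    have hm : Measurable fun p : ℝ × (Fin m → ℝ) => B.indicator
          (fun x => ENNReal.ofReal (q (partialSums m (p.1, x)))) p.2 := by
      have : (fun p : ℝ × (Fin m → ℝ) => B.indicator
          (fun x => ENNReal.ofReal (q (partialSums m (p.1, x)))) p.2) =
          (Prod.snd ⁻¹' B).indicator (fun p => ENNReal.ofReal (q (partialSums m p))) := by
        rfl
      rw [this]
      exact (hq.comp hS).measurable.ennreal_ofReal.indicator (measurable_snd hB)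
    simp_rw [h1]
    rw [(measurePreserving_headIncrements m).lintegral_comp hm, Measure.volume_eq_prod,
      lintegral_prod_symm _ hm.aemeasurable]
    refine lintegral_congr fun x => ?_
    by_cases hx : x ∈ B
    · simp only [hx, Set.indicator_of_mem]
      rw [ofReal_integral_eq_lintegral_ofReal (hint x) (ae_of_all _ fun a => hq0 _)]
    · simp [hx]

/-! ### Mollification and the local time of one path -/

namespace IntersectionLocalTime

section Mollify

variable {f : ℝ → ℝ} {m : ℕ} {ε : ℝ}

lemma rescale_nonneg (hf : ∀ y, 0 ≤ f y) (hε : 0 < ε) (y : ℝ) : 0 ≤ rescale f ε y := by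
  have := hf (y / ε)
  unfold rescale
  positivity

lemma integrable_rescale_sub (hf : Integrable f) (hε : 0 < ε) (x : ℝ) :
    Integrable fun y => rescale f ε (y - x) :=
  ((hf.comp_div hε.ne').const_mul ε⁻¹).comp_sub_right x

lemma integral_rescale_sub (hf : ∫ y, f y = 1) (hε : 0 < ε) (x : ℝ) :
    ∫ y, rescale f ε (y - x) = 1 := by
  rw [integral_sub_right_eq_self (fun y => rescale f ε y)]
  unfold rescale
  rw [integral_const_mul, Measure.integral_comp_div f ε, hf, abs_of_pos hε]
  simp [hε.ne']

lemma abs_le_of_rescale_ne_zero (hf : Function.support f ⊆ Set.Icc (-1) 1) (hε : 0 < ε) {y : ℝ}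
    (h : rescale f ε y ≠ 0) : |y| ≤ ε := by
  have h1 : f (y / ε) ≠ 0 := right_ne_zero_of_mul h
  have h2 := abs_le.2 (hf h1)
  rwa [abs_div, abs_of_pos hε, div_le_one hε] at h2

/-- Mollification of a continuous compactly supported function converges uniformly. -/
lemma tendstoUniformly_mollify (hfi : Integrable f) (hf0 : ∀ y, 0 ≤ f y)
    (hfs : Function.support f ⊆ Set.Icc (-1) 1) (hf1 : ∫ y, f y = 1)
    {G : (Fin m → ℝ) → ℝ} (hG : Continuous G) (hGc : HasCompactSupport G) :
    TendstoUniformly (fun ε x => ∫ y : Fin m → ℝ, G y * ∏ j, rescale f ε (y j - x j)) G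
      (𝓝[>] (0 : ℝ)) := by
  rw [Metric.tendstoUniformly_iff]
  intro η hη
  obtain ⟨δ, hδ, hδG⟩ := Metric.uniformContinuous_iff.1
    (hGc.uniformContinuous_of_continuous hG) (η / 2) (by positivity)
  filter_upwards [Ioo_mem_nhdsGT hδ] with ε hε x
  have hint : Integrable fun y : Fin m → ℝ => ∏ j, rescale f ε (y j - x j) :=
    Integrable.fintype_prod fun j => integrable_rescale_sub hfi hε.1 (x j)
  have hone : ∫ y : Fin m → ℝ, ∏ j, rescale f ε (y j - x j) = 1 := by
    rw [integral_fintype_prod_volume_eq_prod (fun j y => rescale f ε (y - x j))]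
    exact Finset.prod_eq_one fun j _ => integral_rescale_sub hf1 hε.1 (x j)
  obtain ⟨B, hB⟩ := hGc.exists_bound_of_continuous hG
  have hint' : Integrable fun y : Fin m → ℝ => G y * ∏ j, rescale f ε (y j - x j) :=
    hint.bdd_mul hG.aestronglyMeasurable (ae_of_all _ hB)
  -- The kernel has mass one and lives within sup-distance `ε` of `x`, so uniform continuity of `G`
  -- controls the difference.
  have e : (∫ y : Fin m → ℝ, G y * ∏ j, rescale f ε (y j - x j)) - G x =
      ∫ y : Fin m → ℝ, (G y - G x) * ∏ j, rescale f ε (y j - x j) := by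
    simp_rw [sub_mul]
    rw [integral_sub hint' (hint.const_mul _), integral_const_mul, hone, mul_one]
  rw [dist_comm, Real.dist_eq, e, ← Real.norm_eq_abs]
  calc _ ≤ ∫ y : Fin m → ℝ, (η / 2) * ∏ j, rescale f ε (y j - x j) := by
        refine norm_integral_le_of_norm_le (hint.const_mul _) (ae_of_all _ fun y => ?_)
        have hp : 0 ≤ ∏ j, rescale f ε (y j - x j) :=
          Finset.prod_nonneg fun j _ => rescale_nonneg hf0 hε.1 _
        rw [norm_mul, Real.norm_of_nonneg hp]
        by_cases h0 : ∏ j, rescale f ε (y j - x j) = 0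
        · rw [h0]; simp
        · gcongr
          refine (hδG (lt_of_le_of_lt ?_ hε.2)).le
          rw [dist_pi_le_iff hε.1.le]
          intro j
          exact abs_le_of_rescale_ne_zero hfs hε.1 (Finset.prod_ne_zero_iff.1 h0 j (Finset.mem_univ j))
    _ = η / 2 := by rw [integral_const_mul, hone, mul_one]
    _ < η := by linarith

end Mollify

lemma measurable_increments {m : ℕ} {w : ℝ≥0 → ℝ} (hw : Measurable w) :
    Measurable (increments w : (Fin (m + 1) → ℝ) → Fin m → ℝ) := by
  unfold increments
  fun_prop

lemma volume_orderedTimes_lt_top (m : ℕ) (T : ℝ) : volume (orderedTimes m T) < ⊤ := by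
  refine lt_of_le_of_lt (measure_mono fun t ht => ?_)
    (isCompact_Icc (a := fun _ : Fin (m + 1) => (0 : ℝ)) (b := fun _ => T)).measure_lt_top
  exact ⟨fun j => ht.1.trans (ht.2.1 (Fin.zero_le j)), fun j => (ht.2.1 (Fin.le_last j)).trans ht.2.2⟩

/-- If the occupation measure of the increments has a continuous compactly supported density, then
this density is the intersection local time. -/
theorem limit_of_density {f : ℝ → ℝ} (hf : Continuous f) (hf0 : ∀ y, 0 ≤ f y)
    (hfs : Function.support f ⊆ Set.Icc (-1) 1) (hf1 : ∫ y, f y = 1)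
    {m : ℕ} {w : ℝ≥0 → ℝ} (hw : Measurable w) {T : ℝ}
    {G : (Fin m → ℝ) → ℝ} (hG : Continuous G) (hG0 : ∀ x, 0 ≤ G x) (hGc : HasCompactSupport G)
    (h : (volume.restrict (orderedTimes m T)).map (increments w) =
      volume.withDensity (fun x => ENNReal.ofReal (G x))) :
    (∀ K : Set (Fin m → ℝ), IsCompact K →
        TendstoUniformlyOn (fun ε x => approx f w T ε x) (fun x => limit f w T x)
          (𝓝[>] (0 : ℝ)) K) ∧
      Continuous (fun x : Fin m → ℝ => limit f w T x) ∧
      ∀ Φ : (Fin m → ℝ) → ℝ, Measurable Φ → (∃ C : ℝ, ∀ x, |Φ x| ≤ C) →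
        Integrable (fun x : Fin m → ℝ => Φ x * limit f w T x) ∧
        IntegrableOn (fun t => Φ (increments w t)) (orderedTimes m T) ∧
        ∫ x : Fin m → ℝ, Φ x * limit f w T x =
          ∫ t in orderedTimes m T, Φ (increments w t) := by
  have hfi : Integrable f := hf.integrable_of_hasCompactSupport
    (HasCompactSupport.of_support_subset_isCompact isCompact_Icc hfs)
  have hmap : ∀ F : (Fin m → ℝ) → ℝ, Measurable F →
      ∫ t in orderedTimes m T, F (increments w t) = ∫ y, G y * F y := by
    intro F hF
    rw [← integral_map (measurable_increments hw).aemeasurable hF.aestronglyMeasurable, h,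
      integral_withDensity_eq_integral_toReal_smul hG.measurable.ennreal_ofReal
        (ae_of_all _ fun _ => ENNReal.ofReal_lt_top)]
    simp_rw [ENNReal.toReal_ofReal (hG0 _), smul_eq_mul]
  have happrox : ∀ ε x, approx f w T ε x = ∫ y : Fin m → ℝ, G y * ∏ j, rescale f ε (y j - x j) := by
    intro ε x
    refine hmap (fun y => ∏ j, rescale f ε (y j - x j)) ?_
    have : Measurable f := hf.measurable
    unfold rescale
    fun_prop
  have hunif : TendstoUniformly (fun ε x => approx f w T ε x) G (𝓝[>] (0 : ℝ)) := by
    simp_rw [happrox]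
    exact tendstoUniformly_mollify hfi hf0 hfs hf1 hG hGc
  have hlim : (fun x => limit f w T x) = G := by
    funext x
    exact (hunif.tendsto_at x).limUnder_eq
  have hlim' : ∀ x, limit f w T x = G x := fun x => congrFun hlim x
  rw [hlim]
  simp_rw [hlim']
  refine ⟨fun K _ => hunif.tendstoUniformlyOn, hG, fun Φ hΦ ⟨C, hC⟩ => ⟨?_, ?_, ?_⟩⟩
  · exact (hG.integrable_of_hasCompactSupport hGc).bdd_mul hΦ.aestronglyMeasurable (ae_of_all _ hC)
  · exact Measure.integrableOn_of_bounded (M := C) (volume_orderedTimes_lt_top m T).ne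
      (hΦ.comp (measurable_increments hw)).aestronglyMeasurable (ae_of_all _ fun t => hC _)
  · rw [hmap Φ hΦ]
    simp_rw [mul_comm]

/-- If a continuous path has occupation measures with small continuous densities on short time
intervals, then its increments at ordered times have a continuous density. -/
theorem exists_density_increments_orderedTimes {w : ℝ≥0 → ℝ} (hw : Continuous w) (T : ℝ)
    (hloc : ∀ η : ℝ, 0 < η → ∃ δ : ℝ, 0 < δ ∧ ∀ a b, 0 ≤ a → a ≤ b → b ≤ T → b - a ≤ δ →
      ∃ q : ℝ → ℝ, Continuous q ∧ (∀ x, 0 ≤ q x) ∧ (∀ x, q x ≤ η) ∧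
        (volume.restrict (Set.Ico a b)).map (fun t => w t.toNNReal) =
          volume.withDensity (fun x => ENNReal.ofReal (q x)))
    (htot : 0 < T → ∃ (M : ℝ) (Q : ℝ → ℝ), Continuous Q ∧ (∀ x, 0 ≤ Q x) ∧ (∀ x, Q x ≤ M) ∧
      (volume.restrict (Set.Ico 0 T)).map (fun t => w t.toNNReal) =
        volume.withDensity (fun x => ENNReal.ofReal (Q x))) (m : ℕ) :
    ∃ G : (Fin m → ℝ) → ℝ, Continuous G ∧ (∀ x, 0 ≤ G x) ∧ HasCompactSupport G ∧
      (volume.restrict (orderedTimes m T)).map (increments w) =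
        volume.withDensity (fun x => ENNReal.ofReal (G x)) := by
  have hu : Continuous fun t : ℝ => w t.toNNReal := by fun_prop
  -- For `T ≤ 0` the ordered times form a null set, and the density is zero.
  rcases le_or_gt T 0 with hT | hT
  · refine ⟨fun _ => 0, continuous_const, fun _ => le_rfl, HasCompactSupport.zero, ?_⟩
    have h0 : volume (orderedTimes m T) = 0 := by
      rw [measure_congr (orderedTimes_ae_eq m T)]
      convert measure_empty (μ := (volume : Measure (Fin (m + 1) → ℝ)))
      refine Set.eq_empty_of_forall_notMem fun t ht => ?_
      have := ht.2.1 (Fin.zero_le (Fin.last m))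
      linarith [ht.1, ht.2.2]
    rw [Measure.restrict_eq_zero.2 h0]
    simp
  obtain ⟨M, Q, hQc, hQ0, hQM, hQ⟩ := htot hT
  obtain ⟨q, hqc, hq0, hq⟩ := exists_continuous_density_ordered hu.measurable hT hloc hQc hQ0 hQM
    hQ m
  obtain ⟨R, hR⟩ := (isCompact_Icc (a := (0 : ℝ)) (b := T)).exists_bound_of_continuousOn
    hu.continuousOn
  have hU : Measurable fun (t : Fin (m + 1) → ℝ) j => w (t j).toNNReal := by
    have := hw.measurable
    fun_prop
  -- The path is bounded by `R` on `[0, T]`, so the image measure gives no mass to the open set `R <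
  -- |y j|`.
  have hqR : ∀ y, q y ≠ 0 → ∀ j, |y j| ≤ R := by
    intro y hy j
    by_contra! hj
    refine hy (eq_zero_of_withDensity_apply_eq_zero (ν := volume) (O := {y | R < |y j|}) hqc hq0
      (isOpen_lt continuous_const (by fun_prop)) ?_ y hj)
    have hO : MeasurableSet {y : Fin (m + 1) → ℝ | R < |y j|} :=
      measurableSet_lt measurable_const (by fun_prop)
    rw [← hq, Measure.map_apply hU hO, Measure.restrict_apply (hU hO)]
    convert measure_empty (μ := (volume : Measure (Fin (m + 1) → ℝ)))
    refine Set.eq_empty_of_forall_notMem fun t ht => ?_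
    have h1 := hR (t j) ⟨ht.2.1.trans (ht.2.2.1 (Fin.zero_le j)),
      (ht.2.2.1 (Fin.le_last j)).trans ht.2.2.2⟩
    have h2 : R < |w (t j).toNNReal| := ht.1
    rw [Real.norm_eq_abs] at h1
    linarith
  obtain ⟨G, hGc, hG0, hGs, hG⟩ := exists_continuous_density_increments hqc hq0 hqR
  refine ⟨G, hGc, hG0, hGs, ?_⟩
  rw [← hG, ← hq, Measure.map_map (by fun_prop) hU]
  rfl

end IntersectionLocalTime

/-! ### Occupation measures of time intervals -/

/-- The occupation measure of the path `u` over the time interval `[a, b)`. -/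
noncomputable def occupation (u : ℝ → ℝ) (a b : ℝ) : Measure ℝ :=
  (volume.restrict (Set.Ico a b)).map u

instance (u : ℝ → ℝ) (a b : ℝ) : IsFiniteMeasure (occupation u a b) := by
  unfold occupation; infer_instance

lemma occupation_real_apply {u : ℝ → ℝ} (hu : Measurable u) (a b : ℝ) {B : Set ℝ}
    (hB : MeasurableSet B) : (occupation u a b).real B = volume.real (u ⁻¹' B ∩ Set.Ico a b) := by
  rw [measureReal_def, occupation, Measure.map_apply hu hB, Measure.restrict_apply (hu hB)]
  rfl

lemma occupation_real_univ {u : ℝ → ℝ} (hu : Measurable u) {a b : ℝ} (hab : a ≤ b) :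
    (occupation u a b).real Set.univ = b - a := by
  rw [occupation_real_apply hu _ _ MeasurableSet.univ, Set.preimage_univ, Set.univ_inter,
    Real.volume_real_Ico_of_le hab]

lemma occupation_real_add {u : ℝ → ℝ} (hu : Measurable u) {a b c : ℝ} (hab : a ≤ b) (hbc : b ≤ c)
    {B : Set ℝ} (hB : MeasurableSet B) :
    (occupation u a b).real B + (occupation u b c).real B = (occupation u a c).real B := by
  rw [occupation_real_apply hu _ _ hB, occupation_real_apply hu _ _ hB,
    occupation_real_apply hu _ _ hB, ← Set.Ico_union_Ico_eq_Ico hab hbc, Set.inter_union_distrib_left]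
  refine (measureReal_union ?_ ((hu hB).inter measurableSet_Ico) ?_ ?_).symm
  · exact (Set.Ico_disjoint_Ico_same).mono Set.inter_subset_right Set.inter_subset_right
  · exact ((measure_mono Set.inter_subset_right).trans_lt measure_Ico_lt_top).ne
  · exact ((measure_mono Set.inter_subset_right).trans_lt measure_Ico_lt_top).ne

/-- Densities of the occupation measures, from a bound on the occupation of neighbouring dyadic
intervals that is uniform in time. -/
lemma exists_continuous_density_occupation {u : ℝ → ℝ} (hu : Measurable u) {T C ρ : ℝ}
    (hρ : 0 < ρ) (hρ1 : ρ < 1)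
    (h : ∀ t, 0 ≤ t → t ≤ T → ∀ (n : ℕ) (k : ℤ), |(occupation u 0 t).real (dyadicIco n k) -
      (occupation u 0 t).real (dyadicIco n (k + 1))| ≤ C * (ρ / 2) ^ n)
    {a b : ℝ} (ha : 0 ≤ a) (hab : a ≤ b) (hb : b ≤ T) :
    ∃ q : ℝ → ℝ, Continuous q ∧ (∀ x, 0 ≤ q x) ∧
      (∀ n x, q x ≤ 2 ^ n * (b - a) + 2 * C * ρ ^ n / (1 - ρ)) ∧
      occupation u a b = volume.withDensity (fun x => ENNReal.ofReal (q x)) := by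
  rw [← occupation_real_univ hu hab]
  refine exists_continuous_density_of_dyadic hρ hρ1 fun n k => ?_
  -- The occupation of `[a, b)` is that of `[0, b)` minus that of `[0, a)`, whence the factor two in
  -- front of `C`.
  have h1 := occupation_real_add hu ha hab (measurableSet_dyadicIco n k)
  have h2 := occupation_real_add hu ha hab (measurableSet_dyadicIco n (k + 1))
  have h3 := abs_le.1 (h a ha (hab.trans hb) n k)
  have h4 := abs_le.1 (h b (ha.trans hab) hb n k)
  rw [abs_le]
  constructor <;> linarith [h3.1, h3.2, h4.1, h4.2]

namespace IntersectionLocalTime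

/-- A path whose occupation of neighbouring dyadic intervals is close, uniformly in time, has an
occupation density for its increments at ordered times. -/
theorem exists_density_of_dyadic_bound {w : ℝ≥0 → ℝ} (hw : Continuous w) {T C ρ : ℝ}
    (hρ : 0 < ρ) (hρ1 : ρ < 1)
    (h : ∀ t, 0 ≤ t → t ≤ T → ∀ (n : ℕ) (k : ℤ),
      |(occupation (fun t => w t.toNNReal) 0 t).real (dyadicIco n k) -
      (occupation (fun t => w t.toNNReal) 0 t).real (dyadicIco n (k + 1))| ≤ C * (ρ / 2) ^ n)
    (m : ℕ) :
    ∃ G : (Fin m → ℝ) → ℝ, Continuous G ∧ (∀ x, 0 ≤ G x) ∧ HasCompactSupport G ∧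
      (volume.restrict (orderedTimes m T)).map (increments w) =
        volume.withDensity (fun x => ENNReal.ofReal (G x)) := by
  have hu : Measurable fun t : ℝ => w t.toNNReal := by
    have := hw.measurable
    fun_prop
  refine exists_density_increments_orderedTimes hw T (fun η hη => ?_) (fun hT => ?_) m
  · have hlim : Tendsto (fun n : ℕ => 2 * C / (1 - ρ) * ρ ^ n) atTop (𝓝 0) := by
      simpa using (tendsto_pow_atTop_nhds_zero_of_lt_one hρ.le hρ1).const_mul (2 * C / (1 - ρ))
    -- The order `n` is fixed first to make the geometric tail small; then `b - a` is taken small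
    -- compared with `2⁻ⁿ`.
    obtain ⟨n, hn⟩ := (hlim.eventually (gt_mem_nhds (half_pos hη))).exists
    refine ⟨η / 2 / 2 ^ n, by positivity, fun a b ha hab hb hδ => ?_⟩
    obtain ⟨q, hqc, hq0, hq1, hq⟩ := exists_continuous_density_occupation hu hρ hρ1 h ha hab hb
    refine ⟨q, hqc, hq0, fun x => (hq1 n x).trans ?_, hq⟩
    rw [le_div_iff₀ (by positivity)] at hδ
    have e : 2 * C * ρ ^ n / (1 - ρ) = 2 * C / (1 - ρ) * ρ ^ n := by ring
    rw [e]
    linarith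
  · obtain ⟨q, hqc, hq0, hq1, hq⟩ :=
      exists_continuous_density_occupation hu hρ hρ1 h le_rfl hT.le le_rfl
    exact ⟨_, q, hqc, hq0, hq1 0, hq⟩

end IntersectionLocalTime

/-! ### Heat kernel estimates -/

/-- The heat kernel `p_r(x)` on the real line. -/
noncomputable def heatKernel (r x : ℝ) : ℝ := (√(2 * Real.pi * r))⁻¹ * Real.exp (-x ^ 2 / (2 * r))

/-- A dominating function for the heat kernel and its Hölder constant of order `1 / 2`. -/
noncomputable def heatBound (r : ℝ) : ℝ := r ^ (-1 / 2 : ℝ) + r ^ (-3 / 4 : ℝ)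

lemma measurable_heatKernel : Measurable fun q : ℝ × ℝ => heatKernel q.1 q.2 := by
  unfold heatKernel
  fun_prop

lemma heatKernel_eq_gaussianPDFReal {r : ℝ} (hr : 0 ≤ r) (x : ℝ) :
    heatKernel r x = gaussianPDFReal 0 r.toNNReal x := by
  simp [heatKernel, gaussianPDFReal, Real.coe_toNNReal r hr]

lemma heatKernel_nonneg (r x : ℝ) : 0 ≤ heatKernel r x := by
  unfold heatKernel; positivity

lemma inv_sqrt_le {r : ℝ} (hr : 0 < r) : (√(2 * Real.pi * r))⁻¹ ≤ r ^ (-1 / 2 : ℝ) := by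
  rw [show (-1 / 2 : ℝ) = -(1 / 2) by norm_num, Real.rpow_neg hr.le, ← Real.sqrt_eq_rpow]
  gcongr
  nlinarith [Real.pi_gt_three]

lemma heatKernel_le {r : ℝ} (hr : 0 < r) (x : ℝ) : heatKernel r x ≤ heatBound r := by
  have h1 : Real.exp (-x ^ 2 / (2 * r)) ≤ 1 := by
    rw [Real.exp_le_one_iff, neg_div]
    simp only [Left.neg_nonpos_iff]; positivity
  have h2 : 0 ≤ r ^ (-3 / 4 : ℝ) := by positivity
  unfold heatKernel heatBound
  calc _ ≤ r ^ (-1 / 2 : ℝ) * 1 := by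
        gcongr
        exact inv_sqrt_le hr
    _ ≤ _ := by linarith

lemma abs_exp_neg_sq_sub_le (x y : ℝ) :
    |Real.exp (-x ^ 2 / 2) - Real.exp (-y ^ 2 / 2)| ≤ |x - y| := by
  have hd : ∀ x : ℝ, HasDerivAt (fun x : ℝ => Real.exp (-x ^ 2 / 2))
      (Real.exp (-x ^ 2 / 2) * (-x)) x := fun x => by
    have h := ((hasDerivAt_pow 2 x).fun_neg.div_const 2).exp
    convert h using 1
    push_cast
    ring
  have := Convex.norm_image_sub_le_of_norm_hasDerivWithin_le (C := 1)
    (fun x (_ : x ∈ Set.univ) => (hd x).hasDerivWithinAt) (fun x _ => ?_) convex_univ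
    (Set.mem_univ y) (Set.mem_univ x)
  · simpa using this
  · rw [norm_mul, norm_neg, Real.norm_of_nonneg (Real.exp_pos _).le, Real.norm_eq_abs, neg_div,
      Real.exp_neg, inv_mul_le_iff₀ (Real.exp_pos _)]
    have h1 := Real.add_one_le_exp (x ^ 2 / 2)
    have h2 : |x| ≤ x ^ 2 / 2 + 1 := by
      rw [← sq_abs]; nlinarith [sq_nonneg (|x| - 1)]
    linarith

/-- A Lipschitz bound would cost `r⁻¹`, which is not integrable at zero. Interpolating it with the
trivial bound, by `min 1 a ≤ √a`, costs only `r ^ (-3/4)`. -/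
lemma abs_heatKernel_sub_le {r : ℝ} (hr : 0 < r) (x y : ℝ) :
    |heatKernel r x - heatKernel r y| ≤ heatBound r * √|x - y| := by
  have hsr : 0 < √r := Real.sqrt_pos.2 hr
  have e : ∀ x, Real.exp (-x ^ 2 / (2 * r)) = Real.exp (-(x / √r) ^ 2 / 2) := fun x => by
    rw [div_pow, Real.sq_sqrt hr.le]; congr 1; field_simp
  have h1 : |Real.exp (-x ^ 2 / (2 * r)) - Real.exp (-y ^ 2 / (2 * r))| ≤ |x - y| / √r := by
    rw [e, e]
    refine (abs_exp_neg_sq_sub_le _ _).trans (le_of_eq ?_)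
    rw [← sub_div, abs_div, abs_of_pos hsr]
  have h01 : ∀ x : ℝ, Real.exp (-x ^ 2 / (2 * r)) ≤ 1 := fun x => by
    rw [Real.exp_le_one_iff, neg_div]
    simp only [Left.neg_nonpos_iff]; positivity
  have h2 : |Real.exp (-x ^ 2 / (2 * r)) - Real.exp (-y ^ 2 / (2 * r))| ≤ 1 := by
    rw [abs_le]
    constructor <;> linarith [h01 x, h01 y, Real.exp_pos (-x ^ 2 / (2 * r)),
      Real.exp_pos (-y ^ 2 / (2 * r))]
  have h3 : |Real.exp (-x ^ 2 / (2 * r)) - Real.exp (-y ^ 2 / (2 * r))| ≤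
      r ^ (-1 / 4 : ℝ) * √|x - y| := by
    have : r ^ (-1 / 4 : ℝ) * √|x - y| = √(|x - y| / √r) := by
      have h4 : √(√r) = r ^ (1 / 4 : ℝ) := by
        rw [Real.sqrt_eq_rpow r, Real.sqrt_eq_rpow (r ^ (1 / 2 : ℝ)), ← Real.rpow_mul hr.le]
        norm_num
      rw [Real.sqrt_div (abs_nonneg _), h4, mul_comm, neg_div, Real.rpow_neg hr.le,
        ← div_eq_mul_inv]
    rw [this]
    refine Real.le_sqrt_of_sq_le ?_
    nlinarith [abs_nonneg (Real.exp (-x ^ 2 / (2 * r)) - Real.exp (-y ^ 2 / (2 * r)))]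
  unfold heatKernel heatBound
  rw [← mul_sub, abs_mul, abs_of_nonneg (by positivity)]
  calc _ ≤ r ^ (-1 / 2 : ℝ) * (r ^ (-1 / 4 : ℝ) * √|x - y|) := by
        gcongr
        exact inv_sqrt_le hr
    _ = r ^ (-3 / 4 : ℝ) * √|x - y| := by
        rw [← mul_assoc, ← Real.rpow_add hr]; norm_num
    _ ≤ _ := by
        gcongr
        have : 0 ≤ r ^ (-1 / 2 : ℝ) := by positivity
        linarith

lemma heatBound_nonneg {r : ℝ} (hr : 0 ≤ r) : 0 ≤ heatBound r := by
  unfold heatBound; positivity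

lemma integrableOn_heatBound (t : ℝ) : IntegrableOn heatBound (Set.Ioc 0 t) := by
  rcases le_or_gt t 0 with ht | ht
  · rw [Set.Ioc_eq_empty (by linarith)]; exact integrableOn_empty
  rw [← intervalIntegrable_iff_integrableOn_Ioc_of_le ht.le]
  exact (intervalIntegral.intervalIntegrable_rpow' (by norm_num)).add
    (intervalIntegral.intervalIntegrable_rpow' (by norm_num))

lemma setIntegral_heatBound_le {t T : ℝ} (hT : 1 ≤ T) (htT : t ≤ T) :
    ∫ r in Set.Ioc 0 t, heatBound r ≤ 6 * T := by
  rcases le_or_gt t 0 with ht | ht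
  · rw [Set.Ioc_eq_empty (by linarith)]; simp; linarith
  rw [← intervalIntegral.integral_of_le ht.le]
  unfold heatBound
  rw [intervalIntegral.integral_add (intervalIntegral.intervalIntegrable_rpow' (by norm_num))
    (intervalIntegral.intervalIntegrable_rpow' (by norm_num)),
    integral_rpow (Or.inl (by norm_num)), integral_rpow (Or.inl (by norm_num))]
  -- The integral is `2 t ^ (1/2) + 4 t ^ (1/4)`, and each power is at most `T` because `T ≥ 1`.
  norm_num
  have h1 : t ^ (1 / 2 : ℝ) ≤ T := by
    calc t ^ (1 / 2 : ℝ) ≤ T ^ (1 / 2 : ℝ) := by gcongr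
      _ ≤ T ^ (1 : ℝ) := Real.rpow_le_rpow_of_exponent_le hT (by norm_num)
      _ = T := Real.rpow_one T
  have h2 : t ^ (1 / 4 : ℝ) ≤ T := by
    calc t ^ (1 / 4 : ℝ) ≤ T ^ (1 / 4 : ℝ) := by gcongr
      _ ≤ T ^ (1 : ℝ) := Real.rpow_le_rpow_of_exponent_le hT (by norm_num)
      _ = T := Real.rpow_one T
  linarith

/-! ### The moment recursion and its bounds -/

/-- The candidate for the moments of `∫₀ᵗ g (z + W_r) dr`, `W` a Brownian motion. -/
noncomputable def momentFun (g : ℝ → ℝ) : ℕ → ℝ → ℝ → ℝ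
  | 0 => fun _ _ => 1
  | n + 1 => fun t z => (n + 1) * ∫ r in Set.Ioc 0 t, ∫ y, g y * momentFun g n (t - r) y *
      heatKernel r (y - z)

lemma measurable_momentFun_inner {g : ℝ → ℝ} {v : ℝ → ℝ → ℝ} (hg : Measurable g)
    (hv : Measurable (Function.uncurry v)) :
    Measurable fun q : (ℝ × ℝ) × ℝ =>
      ∫ y, g y * v (q.1.1 - q.2) y * heatKernel q.2 (y - q.1.2) := by
  refine (StronglyMeasurable.integral_prod_right (f := fun (q : (ℝ × ℝ) × ℝ) y =>
      g y * v (q.1.1 - q.2) y * heatKernel q.2 (y - q.1.2)) ?_).measurable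
  refine Measurable.stronglyMeasurable ?_
  have h1 : Measurable fun x : ((ℝ × ℝ) × ℝ) × ℝ => v (x.1.1.1 - x.1.2) x.2 :=
    hv.comp (by fun_prop : Measurable fun x : ((ℝ × ℝ) × ℝ) × ℝ => (x.1.1.1 - x.1.2, x.2))
  have h2 : Measurable fun x : ((ℝ × ℝ) × ℝ) × ℝ => heatKernel x.1.2 (x.2 - x.1.1.2) :=
    measurable_heatKernel.comp
      (by fun_prop : Measurable fun x : ((ℝ × ℝ) × ℝ) × ℝ => (x.1.2, x.2 - x.1.1.2))
  exact ((hg.comp measurable_snd).mul h1).mul h2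

lemma measurable_momentFun {g : ℝ → ℝ} (hg : Measurable g) (n : ℕ) :
    Measurable (Function.uncurry (momentFun g n)) := by
  induction n with
  | zero => exact measurable_const
  | succ n ih =>
    have h := measurable_momentFun_inner hg ih
    have h1 : Measurable fun q : (ℝ × ℝ) × ℝ => (Set.Ioc 0 q.1.1).indicator
        (fun r => ∫ y, g y * momentFun g n (q.1.1 - r) y * heatKernel r (y - q.1.2)) q.2 := by
      have e : (fun q : (ℝ × ℝ) × ℝ => (Set.Ioc 0 q.1.1).indicator
        (fun r => ∫ y, g y * momentFun g n (q.1.1 - r) y * heatKernel r (y - q.1.2)) q.2) =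
        {q : (ℝ × ℝ) × ℝ | 0 < q.2 ∧ q.2 ≤ q.1.1}.indicator (fun q => ∫ y, g y *
          momentFun g n (q.1.1 - q.2) y * heatKernel q.2 (y - q.1.2)) := rfl
      rw [e]
      refine h.indicator (MeasurableSet.inter ?_ ?_)
      · exact measurableSet_lt measurable_const measurable_snd
      · exact measurableSet_le measurable_snd (by fun_prop)
    have h2 := (StronglyMeasurable.integral_prod_right (ν := volume)
      (f := fun (q : ℝ × ℝ) r => (Set.Ioc 0 q.1).indicator (fun r => ∫ y, g y *
        momentFun g n (q.1 - r) y * heatKernel r (y - q.2)) r) h1.stronglyMeasurable).measurable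
    have e : Function.uncurry (momentFun g (n + 1)) = fun q : ℝ × ℝ => ((n : ℝ) + 1) *
        ∫ r, (Set.Ioc 0 q.1).indicator
        (fun r => ∫ y, g y * momentFun g n (q.1 - r) y * heatKernel r (y - q.2)) r := by
      funext q
      rw [integral_indicator measurableSet_Ioc]
      rfl
    rw [e]
    exact h2.const_mul _

/-- The difference of the indicators of two neighbouring intervals of length `h`. -/
noncomputable def dipole (a h y : ℝ) : ℝ :=
  (Set.Ico a (a + h)).indicator 1 y - (Set.Ico (a + h) (a + h + h)).indicator 1 y

lemma measurable_dipole (a h : ℝ) : Measurable (dipole a h) :=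
  (measurable_one.indicator measurableSet_Ico).sub (measurable_one.indicator measurableSet_Ico)

lemma abs_dipole_le (a h y : ℝ) : |dipole a h y| ≤ 1 := by
  unfold dipole
  by_cases h1 : y ∈ Set.Ico a (a + h)
  · have h2 : y ∉ Set.Ico (a + h) (a + h + h) := fun h2 => by linarith [h1.2, h2.1]
    simp [h1, h2]
  · by_cases h2 : y ∈ Set.Ico (a + h) (a + h + h) <;> simp [h1, h2]

lemma integral_dipole_mul {a h : ℝ} (hh : 0 ≤ h) {F : ℝ → ℝ} (hF : Measurable F) {B : ℝ}
    (hB : ∀ y, |F y| ≤ B) :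
    ∫ y, dipole a h y * F y = ∫ y in Set.Ico a (a + h), (F y - F (y + h)) := by
  have hi : ∀ (c d : ℝ) (F : ℝ → ℝ), Measurable F → (∀ y, |F y| ≤ B) →
      IntegrableOn F (Set.Ico c d) := fun c d F hF hB =>
    Measure.integrableOn_of_bounded measure_Ico_lt_top.ne hF.aestronglyMeasurable
      (ae_of_all _ hB)
  have e : ∀ y, dipole a h y * F y = (Set.Ico a (a + h)).indicator F y -
      (Set.Ico (a + h) (a + h + h)).indicator F y := fun y => by
    unfold dipole
    rw [sub_mul]
    congr 1 <;> simp [Set.indicator]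
  simp_rw [e]
  rw [integral_sub ((integrable_indicator_iff measurableSet_Ico).2 (hi _ _ F hF hB))
    ((integrable_indicator_iff measurableSet_Ico).2 (hi _ _ F hF hB)),
    integral_indicator measurableSet_Ico, integral_indicator measurableSet_Ico,
    integral_sub (hi _ _ F hF hB) (hi _ _ _ (by fun_prop) (fun y => hB _))]
  congr 1
  rw [integral_Ico_eq_integral_Ioc, integral_Ico_eq_integral_Ioc,
    ← intervalIntegral.integral_of_le (by linarith), ← intervalIntegral.integral_of_le (by linarith),
    intervalIntegral.integral_comp_add_right]

/-- Translating the negative half onto the positive one leaves an integral of `F y - F (y + h)` over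
an interval of length `h`. -/
lemma abs_integral_dipole_mul_le {a h : ℝ} (hh : 0 ≤ h) {F : ℝ → ℝ} (hF : Measurable F) {B : ℝ}
    (hB : ∀ y, |F y| ≤ B) {D : ℝ} (hD : ∀ y, |F y - F (y + h)| ≤ D) :
    |∫ y, dipole a h y * F y| ≤ h * D := by
  rw [integral_dipole_mul hh hF hB, ← Real.norm_eq_abs]
  refine (norm_setIntegral_le_of_norm_le_const measure_Ico_lt_top (fun y _ => hD y)).trans ?_
  rw [Real.volume_real_Ico_of_le (by linarith)]
  apply le_of_eq; ring

lemma integrable_dipole (a h : ℝ) : Integrable (dipole a h) :=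
  ((integrable_indicator_iff measurableSet_Ico).2 (integrableOn_const measure_Ico_lt_top.ne)).sub
    ((integrable_indicator_iff measurableSet_Ico).2 (integrableOn_const measure_Ico_lt_top.ne))

lemma abs_setIntegral_le_of_le_heatBound {t T c : ℝ} (hT : 1 ≤ T) (htT : t ≤ T) (hc : 0 ≤ c)
    {Q : ℝ → ℝ} (hQ : ∀ r, 0 < r → r ≤ t → |Q r| ≤ c * heatBound r) :
    |∫ r in Set.Ioc 0 t, Q r| ≤ c * (6 * T) := by
  rw [← Real.norm_eq_abs]
  calc _ ≤ ∫ r in Set.Ioc 0 t, c * heatBound r := by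
        refine norm_integral_le_of_norm_le ((integrableOn_heatBound t).const_mul c) ?_
        exact (ae_restrict_iff' measurableSet_Ioc).2 (ae_of_all _ fun r hr => hQ r hr.1 hr.2)
    _ = c * ∫ r in Set.Ioc 0 t, heatBound r := integral_const_mul _ _
    _ ≤ _ := by
        gcongr
        exact setIntegral_heatBound_le hT htT

section Inner

variable {a h : ℝ} {v : ℝ → ℝ}

lemma measurable_heatKernel_sub (r z : ℝ) : Measurable fun y => heatKernel r (y - z) :=
  measurable_heatKernel.comp (by fun_prop : Measurable fun y : ℝ => (r, y - z))

/-- Here the cancellation pays: both `v` and the heat kernel are Hölder of order `1/2`, which adds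
`√h` to the factor `h` from the length of the interval. -/
lemma abs_inner_le_of_holder (hh : 0 ≤ h) (hv : Measurable v) {S : ℝ}
    (hS : ∀ y, |v y| ≤ S) (hS' : ∀ y y', |v y - v y'| ≤ S * √|y - y'|) {r : ℝ} (hr : 0 < r)
    (z : ℝ) : |∫ y, dipole a h y * v y * heatKernel r (y - z)| ≤
      h * (2 * S * √h) * heatBound r := by
  have hS0 : 0 ≤ S := (abs_nonneg _).trans (hS 0)
  have hκ := heatBound_nonneg hr.le
  have hp := measurable_heatKernel_sub r z
  simp_rw [mul_assoc]
  refine (abs_integral_dipole_mul_le hh (F := fun y => v y * heatKernel r (y - z)) (hv.mul hp)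
    (B := S * heatBound r) (fun y => ?_)
    (D := 2 * (S * (√h * heatBound r))) (fun y => ?_)).trans (le_of_eq (by ring))
  · rw [abs_mul, abs_of_nonneg (heatKernel_nonneg _ _)]
    gcongr
    · exact heatKernel_nonneg _ _
    · exact hS y
    · exact heatKernel_le hr _
  · have e : v y * heatKernel r (y - z) - v (y + h) * heatKernel r (y + h - z) =
        v y * (heatKernel r (y - z) - heatKernel r (y + h - z)) +
          (v y - v (y + h)) * heatKernel r (y + h - z) := by ring
    have h1 := abs_heatKernel_sub_le hr (y - z) (y + h - z)
    have h2 := hS' y (y + h)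
    rw [show y - z - (y + h - z) = -h by ring, abs_neg, abs_of_nonneg hh] at h1
    rw [show y - (y + h) = -h by ring, abs_neg, abs_of_nonneg hh] at h2
    rw [e]
    calc _ ≤ |v y| * |heatKernel r (y - z) - heatKernel r (y + h - z)| +
          |v y - v (y + h)| * heatKernel r (y + h - z) := by
          refine (abs_add_le _ _).trans (le_of_eq ?_)
          rw [abs_mul, abs_mul, abs_of_nonneg (heatKernel_nonneg _ (y + h - z))]
      _ ≤ S * (heatBound r * √h) + (S * √h) * heatBound r := by
          gcongr
          · exact hS y
          · exact heatKernel_nonneg _ _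
          · exact heatKernel_le hr _
      _ = _ := by ring

lemma abs_inner_le (hh : 0 ≤ h) (hv : Measurable v) {M : ℝ} (hM : ∀ y, |v y| ≤ M)
    {r : ℝ} (hr : 0 < r) (z : ℝ) :
    |∫ y, dipole a h y * v y * heatKernel r (y - z)| ≤ 2 * h * M * heatBound r := by
  have hM0 : 0 ≤ M := (abs_nonneg _).trans (hM 0)
  have hp := measurable_heatKernel_sub r z
  have hB : ∀ y, |v y * heatKernel r (y - z)| ≤ M * heatBound r := fun y => by
    rw [abs_mul, abs_of_nonneg (heatKernel_nonneg _ _)]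
    gcongr
    · exact heatKernel_nonneg _ _
    · exact hM y
    · exact heatKernel_le hr _
  simp_rw [mul_assoc]
  refine (abs_integral_dipole_mul_le hh (F := fun y => v y * heatKernel r (y - z)) (hv.mul hp) hB
    (D := 2 * (M * heatBound r))
    (fun y => ?_)).trans (le_of_eq (by ring))
  refine (abs_sub _ _).trans ?_
  linarith [hB y, hB (y + h)]

lemma integrable_inner (hv : Measurable v) {M : ℝ} (hM : ∀ y, |v y| ≤ M)
    {r : ℝ} (hr : 0 < r) (z : ℝ) :
    Integrable fun y => dipole a h y * v y * heatKernel r (y - z) := by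
  have hM0 : 0 ≤ M := (abs_nonneg _).trans (hM 0)
  have hp := measurable_heatKernel_sub r z
  simp_rw [mul_assoc]
  refine (integrable_dipole a h).mul_bdd (c := M * heatBound r) (hv.mul hp).aestronglyMeasurable
    (ae_of_all _ fun y => ?_)
  rw [Real.norm_eq_abs, abs_mul, abs_of_nonneg (heatKernel_nonneg _ _)]
  gcongr
  · exact heatKernel_nonneg _ _
  · exact hM y
  · exact heatKernel_le hr _

/-- Only boundedness of `v` is needed: the Hölder continuity in `z` comes from the heat kernel. -/
lemma abs_inner_sub_le (hh : 0 ≤ h) (hv : Measurable v) {M : ℝ} (hM : ∀ y, |v y| ≤ M)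
    {r : ℝ} (hr : 0 < r) (z z' : ℝ) :
    |(∫ y, dipole a h y * v y * heatKernel r (y - z)) -
      ∫ y, dipole a h y * v y * heatKernel r (y - z')| ≤
      2 * h * M * √|z - z'| * heatBound r := by
  have hM0 : 0 ≤ M := (abs_nonneg _).trans (hM 0)
  have hB : ∀ y, |v y * (heatKernel r (y - z) - heatKernel r (y - z'))| ≤
      M * (heatBound r * √|z - z'|) := fun y => by
    rw [abs_mul]
    gcongr
    · exact hM y
    · have := abs_heatKernel_sub_le hr (y - z) (y - z')
      rwa [show y - z - (y - z') = -(z - z') by ring, abs_neg] at this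
  rw [← integral_sub (integrable_inner hv hM hr z) (integrable_inner hv hM hr z')]
  have e : ∀ y, dipole a h y * v y * heatKernel r (y - z) -
      dipole a h y * v y * heatKernel r (y - z') =
      dipole a h y * (v y * (heatKernel r (y - z) - heatKernel r (y - z'))) := fun y => by ring
  simp_rw [e]
  refine (abs_integral_dipole_mul_le hh
    (F := fun y => v y * (heatKernel r (y - z) - heatKernel r (y - z')))
    (hv.mul ((measurable_heatKernel_sub r z).sub (measurable_heatKernel_sub r z'))) hB
    (D := 2 * (M * (heatBound r * √|z - z'|))) (fun y => ?_)).trans (le_of_eq (by ring))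
  refine (abs_sub _ _).trans ?_
  linarith [hB y, hB (y + h)]

end Inner

section MomentBound

variable {T : ℝ}

lemma abs_momentFun_succ_le_of_holder {a h : ℝ} (hh : 0 ≤ h) (hT : 1 ≤ T) {n : ℕ} {S : ℝ}
    (hS : ∀ t, 0 ≤ t → t ≤ T → ∀ z, |momentFun (dipole a h) n t z| ≤ S)
    (hS' : ∀ t, 0 ≤ t → t ≤ T → ∀ z z',
      |momentFun (dipole a h) n t z - momentFun (dipole a h) n t z'| ≤ S * √|z - z'|)
    {t : ℝ} (ht : 0 ≤ t) (htT : t ≤ T) (z : ℝ) :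
    |momentFun (dipole a h) (n + 1) t z| ≤ (n + 1) * (h * (2 * S * √h) * (6 * T)) := by
  have hS0 : 0 ≤ S := (abs_nonneg _).trans (hS t ht htT 0)
  have hm := measurable_momentFun (measurable_dipole a h) n
  rw [momentFun, abs_mul, abs_of_nonneg (by positivity)]
  gcongr
  refine abs_setIntegral_le_of_le_heatBound hT htT (by positivity) fun r hr hrt => ?_
  exact abs_inner_le_of_holder hh (hm.of_uncurry_left)
    (hS (t - r) (by linarith) (by linarith)) (hS' (t - r) (by linarith) (by linarith)) hr z

lemma abs_momentFun_succ_le {a h : ℝ} (hh : 0 ≤ h) (hT : 1 ≤ T) {n : ℕ} {M : ℝ}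
    (hM : ∀ t, 0 ≤ t → t ≤ T → ∀ z, |momentFun (dipole a h) n t z| ≤ M)
    {t : ℝ} (ht : 0 ≤ t) (htT : t ≤ T) (z : ℝ) :
    |momentFun (dipole a h) (n + 1) t z| ≤ (n + 1) * (2 * h * M * (6 * T)) := by
  have hM0 : 0 ≤ M := (abs_nonneg _).trans (hM t ht htT 0)
  have hm := measurable_momentFun (measurable_dipole a h) n
  rw [momentFun, abs_mul, abs_of_nonneg (by positivity)]
  gcongr
  refine abs_setIntegral_le_of_le_heatBound hT htT (by positivity) fun r hr hrt => ?_
  exact abs_inner_le hh (hm.of_uncurry_left) (hM (t - r) (by linarith) (by linarith)) hr z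

lemma abs_momentFun_succ_sub_le {a h : ℝ} (hh : 0 ≤ h) (hT : 1 ≤ T) {n : ℕ} {M : ℝ}
    (hM : ∀ t, 0 ≤ t → t ≤ T → ∀ z, |momentFun (dipole a h) n t z| ≤ M)
    {t : ℝ} (ht : 0 ≤ t) (htT : t ≤ T) (z z' : ℝ) :
    |momentFun (dipole a h) (n + 1) t z - momentFun (dipole a h) (n + 1) t z'| ≤
      (n + 1) * (2 * h * M * (6 * T)) * √|z - z'| := by
  have hM0 : 0 ≤ M := (abs_nonneg _).trans (hM t ht htT 0)
  have hm := measurable_momentFun (measurable_dipole a h) n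
  have hint : ∀ z, IntegrableOn (fun r => ∫ y, dipole a h y * momentFun (dipole a h) n (t - r) y *
      heatKernel r (y - z)) (Set.Ioc 0 t) := fun z => by
    refine Integrable.mono' ((integrableOn_heatBound t).const_mul (2 * h * M)) ?_ ?_
    · exact ((measurable_momentFun_inner (measurable_dipole a h) hm).comp
        (by fun_prop : Measurable fun r : ℝ => (((t, z), r) : (ℝ × ℝ) × ℝ))).aestronglyMeasurable
    · exact (ae_restrict_iff' measurableSet_Ioc).2 (ae_of_all _ fun r hr =>
        abs_inner_le hh (hm.of_uncurry_left) (hM (t - r) (by linarith [hr.2]) (by linarith [hr.1]))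
          hr.1 z)
  rw [momentFun, ← mul_sub, abs_mul, abs_of_nonneg (by positivity), mul_assoc]
  gcongr
  rw [← integral_sub (hint z) (hint z')]
  refine (abs_setIntegral_le_of_le_heatBound hT htT (c := 2 * h * M * √|z - z'|) (by positivity)
    fun r hr hrt => ?_).trans (le_of_eq (by ring))
  exact abs_inner_sub_le hh (hm.of_uncurry_left) (hM (t - r) (by linarith) (by linarith)) hr z _

/-- The even moments of the dipole occupation gain a power `5 / 2` for each two orders. -/
theorem momentFun_even_bound (hT : 1 ≤ T) (n : ℕ) :
    ∃ c : ℝ, 0 ≤ c ∧ ∀ a h, 0 ≤ h → ∀ t, 0 ≤ t → t ≤ T →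
      (∀ z, |momentFun (dipole a h) (2 * n) t z| ≤ c * (h ^ 2 * √h) ^ n) ∧
      ∀ z z', |momentFun (dipole a h) (2 * n) t z - momentFun (dipole a h) (2 * n) t z'| ≤
        c * (h ^ 2 * √h) ^ n * √|z - z'| := by
  induction n with
  | zero => exact ⟨1, zero_le_one, fun a h hh t ht htT => by simp [momentFun]⟩
  | succ n ih =>
    obtain ⟨c, hc, ih⟩ := ih
    refine ⟨((2 * n + 1 : ℕ) + 1) * (2 * ((2 * n : ℕ) + 1) * (2 * c * (6 * T)) * (6 * T)),
      by positivity, fun a h hh t ht htT => ?_⟩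
    -- The odd step uses the Hölder bound and gains `h √h`. The even step gains `h` from boundedness
    -- alone and restores the Hölder bound, so the induction closes with `h ^ 2 √h`.
    have h1 := fun t ht htT => abs_momentFun_succ_le_of_holder hh hT
      (fun t ht htT => (ih a h hh t ht htT).1) (fun t ht htT => (ih a h hh t ht htT).2)
      (t := t) ht htT
    have h2 := abs_momentFun_succ_le hh hT h1 ht htT
    have h3 := abs_momentFun_succ_sub_le hh hT h1 ht htT
    have e : 2 * (n + 1) = 2 * n + 1 + 1 := by ring
    rw [e]
    refine ⟨fun z => (h2 z).trans (le_of_eq ?_), fun z z' => (h3 z z').trans (le_of_eq ?_)⟩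
    · ring
    · ring

end MomentBound

/-! ### The Markov property and the moments of Brownian occupation -/

/-- `(∫ₐᵇ φ)ⁿ⁺¹ = (n + 1) ∫ₐᵇ φ(r) (∫ᵣᵇ φ)ⁿ dr`. -/
lemma intervalIntegral_pow_succ {φ : ℝ → ℝ} {a b : ℝ} (hφ : IntervalIntegrable φ volume a b)
    (n : ℕ) : (∫ s in a..b, φ s) ^ (n + 1) =
      (n + 1) * ∫ r in a..b, φ r * (∫ s in r..b, φ s) ^ n := by
  -- As `φ` is merely integrable, the chain rule holds almost everywhere and absolute continuity
  -- justifies integrating it.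
  have hAC0 := (hφ.absolutelyContinuousOnInterval_intervalIntegral
    (Set.right_mem_uIcc : b ∈ Set.uIcc a b))
  have hAC : ∀ n : ℕ, AbsolutelyContinuousOnInterval (fun r => (∫ s in b..r, φ s) ^ (n + 1)) a b := by
    intro n
    induction n with
    | zero => simpa using hAC0
    | succ n ih =>
      have := ih.fun_mul hAC0
      simpa only [← pow_succ] using this
  have h1 := (hAC n).integral_deriv_eq_sub
  have h2 : ∫ r in a..b, deriv (fun r => (∫ s in b..r, φ s) ^ (n + 1)) r =
      ∫ r in a..b, (n + 1) * (φ r * (∫ s in b..r, φ s) ^ n) := by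
    refine intervalIntegral.integral_congr_ae ?_
    filter_upwards [hφ.ae_hasDerivAt_integral] with x hx hxm
    have := ((hx (Set.uIoc_subset_uIcc hxm) b Set.right_mem_uIcc).fun_pow (n + 1)).deriv
    rw [this]
    push_cast
    ring
  rw [h2, intervalIntegral.integral_same, intervalIntegral.integral_const_mul] at h1
  have h3 : ∀ r, ∫ s in r..b, φ s = -∫ s in b..r, φ s := fun r =>
    intervalIntegral.integral_symm _ _
  have h4 : ∀ r, φ r * (-∫ s in b..r, φ s) ^ n = (-1) ^ n * (φ r * (∫ s in b..r, φ s) ^ n) :=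
    fun r => by rw [neg_pow]; ring
  simp_rw [h3, h4]
  rw [intervalIntegral.integral_const_mul, neg_pow, pow_succ (-1 : ℝ)]
  linear_combination (-(-1 : ℝ) ^ n) * h1

/-- The value at time `s` of the continuous path `p`, as a measurable function of `p` and `s` for
the product `σ`-algebra on paths. -/
noncomputable def pathEval (p : ℝ≥0 → ℝ) (s : ℝ≥0) : ℝ :=
  limsup (fun n : ℕ => p ((⌊s * 2 ^ n⌋₊ : ℝ≥0) / 2 ^ n)) atTop

lemma tendsto_floor_mul_pow_div (s : ℝ≥0) :
    Tendsto (fun n : ℕ => ((⌊s * 2 ^ n⌋₊ : ℝ≥0) / 2 ^ n)) atTop (𝓝 s) := by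
  have h := (tendsto_nat_floor_mul_div_atTop (a := (s : ℝ)) s.2).comp
    (tendsto_pow_atTop_atTop_of_one_lt (by norm_num : (1 : ℝ) < 2))
  rw [← NNReal.tendsto_coe]
  convert h using 2 with n
  simp only [Function.comp]
  push_cast
  have e : ⌊s * 2 ^ n⌋₊ = ⌊((s * 2 ^ n : ℝ≥0) : ℝ)⌋₊ := (Nonneg.nat_floor_coe (s * 2 ^ n)).symm
  rw [e]
  push_cast
  rfl

lemma pathEval_eq {p : ℝ≥0 → ℝ} (hp : Continuous p) (s : ℝ≥0) : pathEval p s = p s :=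
  ((hp.tendsto s).comp (tendsto_floor_mul_pow_div s)).limsup_eq

/-- Plain evaluation is not jointly measurable for the product `σ`-algebra. Each term of the limsup
depends on `s` through a natural number, so it is. -/
lemma measurable_pathEval : Measurable fun q : (ℝ≥0 → ℝ) × ℝ≥0 => pathEval q.1 q.2 := by
  refine Measurable.limsup fun n => ?_
  have h : Measurable fun q : (ℝ≥0 → ℝ) × ℕ => q.1 ((q.2 : ℝ≥0) / 2 ^ n) :=
    measurable_from_prod_countable_left fun k =>
      show Measurable fun p : ℝ≥0 → ℝ => p ((k : ℝ≥0) / 2 ^ n) from measurable_pi_apply _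
  exact h.comp (measurable_fst.prodMk
    (Nat.measurable_floor.comp (measurable_snd.mul_const _)))

attribute [irreducible] pathEval

lemma measurable_pathEval_shift {g : ℝ → ℝ} (hg : Measurable g) :
    Measurable fun x : (ℝ × (ℝ≥0 → ℝ)) × ℝ => g (x.1.1 + pathEval x.1.2 x.2.toNNReal) := by
  have h0 : Measurable fun x : (ℝ × (ℝ≥0 → ℝ)) × ℝ => (x.1.2, x.2.toNNReal) :=
    (measurable_snd.comp measurable_fst).prodMk (measurable_real_toNNReal.comp measurable_snd)
  have h1 : Measurable fun x : (ℝ × (ℝ≥0 → ℝ)) × ℝ => x.1.1 :=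
    measurable_fst.comp measurable_fst
  exact hg.comp (h1.add (measurable_pathEval.comp h0))

lemma measurable_pathIntegral {g : ℝ → ℝ} (hg : Measurable g) (t : ℝ) :
    Measurable fun q : ℝ × (ℝ≥0 → ℝ) =>
      ∫ s in Set.Ioc 0 t, g (q.1 + pathEval q.2 s.toNNReal) :=
  (StronglyMeasurable.integral_prod_right (ν := volume.restrict (Set.Ioc 0 t))
    (f := fun (q : ℝ × (ℝ≥0 → ℝ)) s => g (q.1 + pathEval q.2 s.toNNReal))
    (measurable_pathEval_shift hg).stronglyMeasurable).measurable

lemma measurable_pathFunctional {g : ℝ → ℝ} (hg : Measurable g) (t : ℝ) (n : ℕ) :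
    Measurable fun q : ℝ × (ℝ≥0 → ℝ) =>
      g q.1 * (∫ s in Set.Ioc 0 t, g (q.1 + pathEval q.2 s.toNNReal)) ^ n :=
  (hg.comp measurable_fst).mul ((measurable_pathIntegral hg t).pow_const n)

section Markov

variable {Ω : Type*} [MeasurableSpace Ω] {P : Measure Ω}

/-- The Markov property at a fixed time for functionals of the future occupation. -/
lemma integral_markov [IsProbabilityMeasure P] {X : Ω → ℝ} (hX : Measurable X)
    {Z : ℝ≥0 → Ω → ℝ} (hZ : ∀ t, Measurable (Z t)) (hZc : ∀ ω, Continuous (Z · ω))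
    (hind : IndepFun X (fun ω t => Z t ω) P) {g : ℝ → ℝ} (hg : Measurable g)
    (hg1 : ∀ y, |g y| ≤ 1) (z : ℝ) (t : ℝ) (ht : 0 ≤ t) (n : ℕ) :
    ∫ ω, g (z + X ω) * (∫ s in Set.Ioc 0 t, g (z + X ω + Z s.toNNReal ω)) ^ n ∂P =
      ∫ x, g (z + x) * (∫ ω, (∫ s in Set.Ioc 0 t, g (z + x + Z s.toNNReal ω)) ^ n ∂P)
        ∂(P.map X) := by
  have hZ' : Measurable fun ω t => Z t ω := measurable_pi_lambda _ hZ
  -- Written with `pathEval`, the functional is measurable on pairs (position, path), so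
  -- independence turns the expectation into an integral against the product of the laws.
  set F : ℝ × (ℝ≥0 → ℝ) → ℝ := fun q =>
    g (z + q.1) * (∫ s in Set.Ioc 0 t, g (z + q.1 + pathEval q.2 s.toNNReal)) ^ n with hF
  have hFm : Measurable F := (measurable_pathFunctional hg t n).comp
    ((measurable_fst.const_add z).prodMk measurable_snd)
  have hFb : ∀ q, ‖F q‖ ≤ 1 * t ^ n := fun q => by
    rw [hF, norm_mul, norm_pow]
    gcongr
    · exact hg1 _
    · refine (norm_setIntegral_le_of_norm_le_const measure_Ioc_lt_top
        (fun s _ => hg1 _)).trans ?_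
      rw [Real.volume_real_Ioc_of_le ht]
      simp
  have hmap := (indepFun_iff_map_prod_eq_prod_map_map hX.aemeasurable hZ'.aemeasurable).1 hind
  have e1 : ∀ ω, g (z + X ω) * (∫ s in Set.Ioc 0 t, g (z + X ω + Z s.toNNReal ω)) ^ n =
      F (X ω, fun t => Z t ω) := fun ω => by
    simp only [hF, pathEval_eq (hZc ω)]
  have e2 : ∀ x, g (z + x) * (∫ ω, (∫ s in Set.Ioc 0 t, g (z + x + Z s.toNNReal ω)) ^ n ∂P) =
      ∫ p, F (x, p) ∂(P.map fun ω t => Z t ω) := fun x => by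
    rw [integral_map hZ'.aemeasurable (f := fun p => F (x, p))
      (hFm.comp measurable_prodMk_left).aestronglyMeasurable,
      ← integral_const_mul]
    simp only [hF, pathEval_eq (hZc _)]
  have := Measure.isProbabilityMeasure_map (μ := P) hX.aemeasurable
  have := Measure.isProbabilityMeasure_map (μ := P) hZ'.aemeasurable
  simp_rw [e1, e2]
  rw [← integral_map (f := F) (hX.prodMk hZ').aemeasurable hFm.aestronglyMeasurable, hmap,
    integral_prod _ (Integrable.of_bound hFm.aestronglyMeasurable _ (ae_of_all _ hFb))]

end Markov

section MomentIdentity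

variable {Ω : Type*} [MeasurableSpace Ω] {P : Measure Ω} [IsProbabilityMeasure P]
  {B : ℝ≥0 → Ω → ℝ} {g : ℝ → ℝ}

lemma indepFun_eval_shift {P : Measure Ω} (hB : IsPreBrownianReal B P) (r : ℝ≥0) :
    IndepFun (B r) (fun ω t => B (r + t) ω - B r ω) P :=
  (hB.indepFun_shift r).symm.comp (φ := fun p : Set.Iic r → ℝ => p ⟨r, Set.mem_Iic.2 le_rfl⟩)
    (measurable_pi_apply (⟨r, Set.mem_Iic.2 le_rfl⟩ : Set.Iic r)) measurable_id

lemma measurable_uncurry_path (hm : ∀ t, Measurable (B t)) (hc : ∀ ω, Continuous (B · ω)) :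
    Measurable fun q : Ω × ℝ≥0 => B q.2 q.1 :=
  (measurable_uncurry_of_continuous_of_measurable (u := B) hc hm).comp measurable_swap

lemma integral_future_eq {φ : ℝ → ℝ} {r t : ℝ} (hrt : r ≤ t) :
    ∫ s in r..t, φ s = ∫ s in Set.Ioc 0 (t - r), φ (r + s) := by
  rw [← intervalIntegral.integral_of_le (by linarith), intervalIntegral.integral_comp_add_left]
  simp

lemma measurable_future (hm : ∀ t, Measurable (B t)) (hc : ∀ ω, Continuous (B · ω))
    (hg : Measurable g) (t z : ℝ) :
    Measurable fun q : Ω × ℝ =>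
      ∫ s in Set.Ioc 0 (t - q.2), g (z + B (q.2.toNNReal + s.toNNReal) q.1) := by
  have h0 := measurable_uncurry_path hm hc
  have h1 : Measurable fun x : (Ω × ℝ) × ℝ => (x.1.1, x.1.2.toNNReal + x.2.toNNReal) := by fun_prop
  have h2 : Measurable fun x : (Ω × ℝ) × ℝ => g (z + B (x.1.2.toNNReal + x.2.toNNReal) x.1.1) :=
    hg.comp ((h0.comp h1).const_add z)
  have h3 : Measurable fun x : (Ω × ℝ) × ℝ => (Set.Ioc 0 (t - x.1.2)).indicator
      (fun s => g (z + B (x.1.2.toNNReal + s.toNNReal) x.1.1)) x.2 := by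
    have e : (fun x : (Ω × ℝ) × ℝ => (Set.Ioc 0 (t - x.1.2)).indicator
      (fun s => g (z + B (x.1.2.toNNReal + s.toNNReal) x.1.1)) x.2) =
      {x : (Ω × ℝ) × ℝ | 0 < x.2 ∧ x.2 ≤ t - x.1.2}.indicator
        (fun x => g (z + B (x.1.2.toNNReal + x.2.toNNReal) x.1.1)) := rfl
    rw [e]
    refine h2.indicator (MeasurableSet.inter ?_ ?_)
    · exact measurableSet_lt measurable_const measurable_snd
    · exact measurableSet_le measurable_snd (by fun_prop)
  have h4 := (StronglyMeasurable.integral_prod_right (ν := volume)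
    (f := fun (q : Ω × ℝ) s => (Set.Ioc 0 (t - q.2)).indicator
      (fun s => g (z + B (q.2.toNNReal + s.toNNReal) q.1)) s) h3.stronglyMeasurable).measurable
  simpa only [integral_indicator measurableSet_Ioc] using h4

/-- The moments of the occupation integrals of Brownian motion. -/
theorem integral_occupation_pow_eq (hB : IsPreBrownianReal B P) (hm : ∀ t, Measurable (B t))
    (hc : ∀ ω, Continuous (B · ω)) (hg : Measurable g) (hg1 : ∀ y, |g y| ≤ 1) (n : ℕ)
    {t : ℝ} (ht : 0 ≤ t) (z : ℝ) :
    ∫ ω, (∫ s in Set.Ioc 0 t, g (z + B s.toNNReal ω)) ^ n ∂P = momentFun g n t z := by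
  induction n generalizing B t z with
  | zero => simp [momentFun]
  | succ n ih =>
    have hint : ∀ ω, IntervalIntegrable (fun s : ℝ => g (z + B s.toNNReal ω)) volume 0 t :=
      fun ω => by
        rw [intervalIntegrable_iff]
        refine Measure.integrableOn_of_bounded (M := 1) measure_Ioc_lt_top.ne
          (Measurable.aestronglyMeasurable ?_) (ae_of_all _ fun s => hg1 _)
        have := (hc ω).measurable
        fun_prop
    -- Here `r` is the earliest of the `n + 1` times, and the remaining power involves only the path
    -- after `r`.
    have e1 : ∀ ω, (∫ s in Set.Ioc 0 t, g (z + B s.toNNReal ω)) ^ (n + 1) =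
        (n + 1) * ∫ r in Set.Ioc 0 t, g (z + B r.toNNReal ω) *
          (∫ s in Set.Ioc 0 (t - r), g (z + B (r.toNNReal + s.toNNReal) ω)) ^ n := fun ω => by
      rw [← intervalIntegral.integral_of_le ht, intervalIntegral_pow_succ (hint ω),
        intervalIntegral.integral_of_le ht]
      congr 1
      refine setIntegral_congr_fun measurableSet_Ioc fun r hr => ?_
      rw [integral_future_eq hr.2]
      congr 2
      refine setIntegral_congr_fun measurableSet_Ioc fun s hs => ?_
      rw [Real.toNNReal_add hr.1.le hs.1.le]
    simp_rw [e1]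
    rw [integral_const_mul, momentFun]
    congr 1
    have hmeas : Measurable fun q : Ω × ℝ => g (z + B q.2.toNNReal q.1) *
        (∫ s in Set.Ioc 0 (t - q.2), g (z + B (q.2.toNNReal + s.toNNReal) q.1)) ^ n := by
      refine Measurable.mul (hg.comp (Measurable.const_add ?_ z))
        ((measurable_future hm hc hg t z).pow_const n)
      exact (measurable_uncurry_path hm hc).comp
        (by fun_prop : Measurable fun q : Ω × ℝ => (q.1, q.2.toNNReal))
    have hbound : ∀ᵐ q : Ω × ℝ ∂(P.prod (volume.restrict (Set.Ioc 0 t))),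
        ‖g (z + B q.2.toNNReal q.1) *
        (∫ s in Set.Ioc 0 (t - q.2), g (z + B (q.2.toNNReal + s.toNNReal) q.1)) ^ n‖ ≤
          1 * t ^ n := by
      have h := (Measure.quasiMeasurePreserving_snd (μ := P)
        (ν := volume.restrict (Set.Ioc 0 t))).ae (ae_restrict_mem measurableSet_Ioc)
      filter_upwards [h] with q hq
      rw [norm_mul, norm_pow]
      gcongr
      · exact hg1 _
      · refine (norm_setIntegral_le_of_norm_le_const measure_Ioc_lt_top
          (fun s _ => hg1 _)).trans ?_
        rw [Real.volume_real_Ioc_of_le (by linarith [hq.2])]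
        linarith [hq.1]
    rw [integral_integral_swap (f := fun ω r => g (z + B r.toNNReal ω) *
        (∫ s in Set.Ioc 0 (t - r), g (z + B (r.toNNReal + s.toNNReal) ω)) ^ n)
        (Integrable.of_bound hmeas.aestronglyMeasurable _ hbound)]
    refine setIntegral_congr_fun measurableSet_Ioc fun r hr => ?_
    set Z : ℝ≥0 → Ω → ℝ := fun s ω => B (r.toNNReal + s) ω - B r.toNNReal ω with hZ
    have hZm : ∀ s, Measurable (Z s) := fun s => (hm _).sub (hm _)
    have hZc : ∀ ω, Continuous (Z · ω) := fun ω => by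
      have := hc ω
      fun_prop
    have htr : 0 ≤ t - r := by linarith [hr.2]
    have hM := integral_markov (hm r.toNNReal) hZm hZc (indepFun_eval_shift hB r.toNNReal) hg hg1 z
      (t - r) htr n
    have e2 : ∀ s ω, z + B r.toNNReal ω + Z s ω = z + B (r.toNNReal + s) ω := fun s ω => by
      rw [hZ]; ring
    simp_rw [e2] at hM
    rw [hM]
    have hr0 : r.toNNReal ≠ 0 := (Real.toNNReal_pos.2 hr.1).ne'
    -- The path restarted at time `r` is again a Brownian motion, so the induction hypothesis
    -- applies to it.
    simp_rw [ih (B := Z) (hB.shift r.toNNReal) hZm hZc htr]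
    rw [(hB.hasLaw_eval r.toNNReal).map_eq, integral_gaussianReal_eq_integral_smul hr0,
      ← integral_sub_right_eq_self _ z]
    refine integral_congr_ae (ae_of_all _ fun y => ?_)
    beta_reduce
    rw [add_sub_cancel, smul_eq_mul, heatKernel_eq_gaussianPDFReal hr.1.le]
    ring

end MomentIdentity

/-! ### Almost sure bounds on neighbouring dyadic intervals -/

/-- A process with almost surely continuous paths, almost everywhere measurable at each time, is
indistinguishable from a measurable process with continuous paths. -/
lemma exists_measurable_continuous_modification {Ω : Type*} [MeasurableSpace Ω] {P : Measure Ω}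
    {W : ℝ≥0 → Ω → ℝ} (hm : ∀ t, AEMeasurable (W t) P) (hc : ∀ᵐ ω ∂P, Continuous (W · ω)) :
    ∃ B : ℝ≥0 → Ω → ℝ, (∀ t, Measurable (B t)) ∧ (∀ ω, Continuous (B · ω)) ∧
      ∀ᵐ ω ∂P, ∀ t, W t ω = B t ω := by
  classical
  set d := TopologicalSpace.denseSeq ℝ≥0
  have hall : ∀ᵐ ω ∂P, Continuous (W · ω) ∧ ∀ n, W (d n) ω = (hm (d n)).mk _ ω :=
    hc.and (ae_all_iff.2 fun n => (hm (d n)).ae_eq_mk)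
  obtain ⟨N, hN, hNm, hN0⟩ := exists_measurable_superset_of_null (ae_iff.1 hall)
  have hS : ∀ ω ∉ N, Continuous (W · ω) ∧ ∀ n, W (d n) ω = (hm (d n)).mk _ ω := fun ω hω => by
    by_contra h
    exact hω (hN h)
  have hcont : ∀ ω, Continuous fun t => Nᶜ.indicator (W t) ω := fun ω => by
    by_cases hω : ω ∈ N
    · simpa [Set.indicator, hω] using continuous_const
    · simpa [Set.indicator, hω] using (hS ω hω).1
  refine ⟨fun t => Nᶜ.indicator (W t), fun t => ?_, hcont, ?_⟩
  · obtain ⟨x, hx, hxt⟩ := mem_closure_iff_seq_limit.1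
      ((TopologicalSpace.denseRange_denseSeq ℝ≥0) t)
    refine measurable_of_tendsto_metrizable (f := fun n => Nᶜ.indicator (W (x n))) (fun n => ?_)
      (tendsto_pi_nhds.2 fun ω => ((hcont ω).tendsto t).comp hxt)
    obtain ⟨k, hk⟩ := hx n
    have : Nᶜ.indicator (W (x n)) = Nᶜ.indicator ((hm (d k)).mk _) := by
      rw [← hk]
      exact Set.indicator_congr fun ω hω => (hS ω hω).2 k
    rw [this]
    exact (hm (d k)).measurable_mk.indicator hNm.compl
  · have : ∀ᵐ ω ∂P, ω ∉ N := measure_eq_zero_iff_ae_notMem.1 hN0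
    filter_upwards [this] with ω hω t
    simp [hω]

lemma setIntegral_dipole_comp {u : ℝ → ℝ} (hu : Measurable u) (a h t : ℝ) :
    ∫ s in Set.Ioc 0 t, dipole a h (u s) = (occupation u 0 t).real (Set.Ico a (a + h)) -
      (occupation u 0 t).real (Set.Ico (a + h) (a + h + h)) := by
  have key : ∫ y, dipole a h y ∂(occupation u 0 t) = ∫ s in Set.Ioc 0 t, dipole a h (u s) := by
    rw [occupation, integral_map hu.aemeasurable (measurable_dipole a h).aestronglyMeasurable,
      restrict_Ico_eq_restrict_Ioc]
  have hi : ∀ b c, Integrable ((Set.Ico b c).indicator (1 : ℝ → ℝ)) (occupation u 0 t) := fun b c =>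
    (integrable_indicator_iff measurableSet_Ico).2 (integrable_const (1 : ℝ)).integrableOn
  rw [← key]
  unfold dipole
  rw [integral_sub (hi _ _) (hi _ _), integral_indicator_one measurableSet_Ico,
    integral_indicator_one measurableSet_Ico]

lemma setIntegral_dipole_dyadic {u : ℝ → ℝ} (hu : Measurable u) (n : ℕ) (k : ℤ) (t : ℝ) :
    ∫ s in Set.Ioc 0 t, dipole (k / 2 ^ n) (1 / 2 ^ n) (u s) =
      (occupation u 0 t).real (dyadicIco n k) - (occupation u 0 t).real (dyadicIco n (k + 1)) := by
  rw [setIntegral_dipole_comp hu, dyadicIco, dyadicIco]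
  push_cast
  rw [add_div, add_div _ (1 : ℝ), add_div]

/-- The sum of all `(Y / δ) ^ (2M)` has finite expectation, hence is almost surely finite and bounds
each of its terms. -/
lemma ae_exists_forall_abs_le {Ω ι : Type*} [MeasurableSpace Ω] {P : Measure Ω}
    {I : ℕ → Finset ι} {Y : ℕ → ι → Ω → ℝ} {M : ℕ} (hM : M ≠ 0) {b δ : ℕ → ℝ}
    (hY : ∀ n i, Integrable (fun ω => Y n i ω ^ (2 * M)) P)
    (hb : ∀ n, ∀ i ∈ I n, ∫ ω, Y n i ω ^ (2 * M) ∂P ≤ b n) (hδ : ∀ n, 0 < δ n)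
    (hs : Summable fun n => (I n).card * b n / δ n ^ (2 * M)) :
    ∀ᵐ ω ∂P, ∃ C : ℝ, ∀ n, ∀ i ∈ I n, |Y n i ω| ≤ C * δ n := by
  have hpos : ∀ n i ω, 0 ≤ Y n i ω ^ (2 * M) := fun n i ω => (even_two_mul M).pow_nonneg _
  set Z : ℕ → Ω → ℝ := fun n ω => (∑ i ∈ I n, Y n i ω ^ (2 * M)) / δ n ^ (2 * M) with hZ
  have hZi : ∀ n, Integrable (Z n) P := fun n =>
    (integrable_finsetSum _ fun i _ => hY n i).div_const _
  have hZ0 : ∀ n ω, 0 ≤ Z n ω := fun n ω =>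
    div_nonneg (Finset.sum_nonneg fun i _ => hpos n i ω) (pow_pos (hδ n) _).le
  have hZb : ∀ n, ∫ ω, Z n ω ∂P ≤ (I n).card * b n / δ n ^ (2 * M) := fun n => by
    rw [hZ]
    simp only
    rw [integral_div, integral_finsetSum _ fun i _ => hY n i]
    have := pow_pos (hδ n) (2 * M)
    gcongr
    simpa using Finset.sum_le_card_nsmul _ _ _ (hb n)
  have hlt : ∫⁻ ω, ∑' n, ENNReal.ofReal (Z n ω) ∂P ≠ ⊤ := by
    rw [lintegral_tsum fun n => (hZi n).aemeasurable.ennreal_ofReal]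
    simp_rw [← fun n => ofReal_integral_eq_lintegral_ofReal (hZi n) (ae_of_all _ (hZ0 n))]
    exact (Summable.of_nonneg_of_le (fun n => integral_nonneg (hZ0 n)) hZb hs).tsum_ofReal_ne_top
  have hmeas : AEMeasurable (fun ω => ∑' n, ENNReal.ofReal (Z n ω)) P :=
    AEMeasurable.tsum fun n => (hZi n).aemeasurable.ennreal_ofReal
  filter_upwards [ae_lt_top' hmeas hlt] with ω hω
  set S := ∑' n, ENNReal.ofReal (Z n ω) with hS
  -- The added one makes the base at least `1`, so it is below its own power and no root has to be
  -- taken.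
  refine ⟨S.toReal + 1, fun n i hi => ?_⟩
  have h1 : Z n ω ≤ S.toReal :=
    (ENNReal.ofReal_le_iff_le_toReal hω.ne).1 (ENNReal.le_tsum n)
  have h2 : (|Y n i ω| / δ n) ^ (2 * M) ≤ (S.toReal + 1) ^ (2 * M) := by
    calc (|Y n i ω| / δ n) ^ (2 * M) = Y n i ω ^ (2 * M) / δ n ^ (2 * M) := by
          rw [div_pow, (even_two_mul M).pow_abs]
      _ ≤ Z n ω := by
          have := pow_pos (hδ n) (2 * M)
          rw [hZ]
          dsimp only
          gcongr
          exact Finset.single_le_sum (f := fun i => Y n i ω ^ (2 * M)) (fun i _ => hpos n i ω) hi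
      _ ≤ S.toReal + 1 := by linarith
      _ ≤ _ := le_self_pow₀ (by linarith [ENNReal.toReal_nonneg (a := S)]) (by omega)
  have h3 := le_of_pow_le_pow_left₀ (by omega) (by positivity) h2
  rwa [div_le_iff₀ (hδ n)] at h3

section DyadicBound

variable {Ω : Type*} [MeasurableSpace Ω] {P : Measure Ω} [IsProbabilityMeasure P]
  {B : ℝ≥0 → Ω → ℝ}

lemma occupation_increment_le {u : ℝ → ℝ} (hu : Measurable u) {s t : ℝ} (hs : 0 ≤ s) (hst : s ≤ t)
    {A : Set ℝ} (hA : MeasurableSet A) :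
    (occupation u 0 s).real A ≤ (occupation u 0 t).real A ∧
      (occupation u 0 t).real A ≤ (occupation u 0 s).real A + (t - s) := by
  have h := occupation_real_add hu hs hst hA
  have h1 : (occupation u s t).real A ≤ t - s :=
    (measureReal_mono (Set.subset_univ A)).trans_eq (occupation_real_univ hu hst)
  have h2 : 0 ≤ (occupation u s t).real A := measureReal_nonneg
  constructor <;> linarith

lemma occupation_real_eq_zero {u : ℝ → ℝ} (hu : Measurable u) {t R : ℝ}
    (hR : ∀ s, 0 ≤ s → s ≤ t → |u s| ≤ R) {n : ℕ} {k : ℤ}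
    (hk : R < k / 2 ^ n ∨ (k + 1) / 2 ^ n < -R) : (occupation u 0 t).real (dyadicIco n k) = 0 := by
  rw [occupation_real_apply hu _ _ (measurableSet_dyadicIco n k)]
  have : u ⁻¹' dyadicIco n k ∩ Set.Ico 0 t = ∅ := by
    refine Set.eq_empty_iff_forall_notMem.2 fun s ⟨h1, h2⟩ => ?_
    rw [Set.mem_preimage, dyadicIco, Set.mem_Ico] at h1
    have h3 := abs_le.1 (hR s h2.1 h2.2.le)
    rcases hk with hk | hk <;> linarith [h1.1, h1.2, h3.1, h3.2]
  rw [this, measureReal_empty]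

/-- The grid bound for the occupation of neighbouring dyadic intervals by Brownian motion. -/
lemma ae_exists_grid_bound (hB : IsPreBrownianReal B P) (hm : ∀ t, Measurable (B t))
    (hc : ∀ ω, Continuous (B · ω)) {N : ℕ} (hN : 1 ≤ N) :
    ∀ᵐ ω ∂P, ∃ C : ℝ, ∀ n, ∀ j : ℕ, j ≤ N * 4 ^ n → ∀ k : ℤ, |k| ≤ N * 2 ^ n →
      |(occupation (fun t => B t.toNNReal ω) 0 (j / 4 ^ n)).real (dyadicIco n k) -
        (occupation (fun t => B t.toNNReal ω) 0 (j / 4 ^ n)).real (dyadicIco n (k + 1))| ≤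
        C * (19 / 20 / 2) ^ n := by
  have hN' : (1 : ℝ) ≤ N := by exact_mod_cast hN
  -- The twentieth moment is of order `2 ^ (-25 n)`, and the grid has order `8 ^ n` points (`4 ^ n`
  -- times, `2 ^ n` places). With `δ n = (19/40) ^ n` the series has ratio `8 * 2⁻²⁵ * (40/19) ^ 20
  -- = (20/19) ^ 20 / 4 < 1`.
  obtain ⟨c, hc0, hcb⟩ := momentFun_even_bound hN' 10
  have hu : ∀ ω, Measurable fun t : ℝ => B t.toNNReal ω := fun ω =>
    (hc ω).measurable.comp measurable_real_toNNReal
  set I : ℕ → Finset (ℕ × ℤ) := fun n => Finset.range (N * 4 ^ n + 1) ×ˢ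
    Finset.Icc (-(N * 2 ^ n : ℤ)) (N * 2 ^ n) with hI
  set Y : ℕ → ℕ × ℤ → Ω → ℝ := fun n i ω => ∫ s in Set.Ioc 0 ((i.1 : ℝ) / 4 ^ n),
    dipole (i.2 / 2 ^ n) (1 / 2 ^ n) (0 + B s.toNNReal ω) with hY
  have hYo : ∀ n i ω, Y n i ω =
      (occupation (fun t => B t.toNNReal ω) 0 (i.1 / 4 ^ n)).real (dyadicIco n i.2) -
      (occupation (fun t => B t.toNNReal ω) 0 (i.1 / 4 ^ n)).real (dyadicIco n (i.2 + 1)) :=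
    fun n i ω => by
      rw [← setIntegral_dipole_dyadic (hu ω)]
      simp [hY]
  have hYm : ∀ n i, Measurable (Y n i) := fun n i => by
    have h1 : Measurable fun q : Ω × ℝ => dipole (i.2 / 2 ^ n) (1 / 2 ^ n) (0 + B q.2.toNNReal q.1) :=
      (measurable_dipole _ _).comp (((measurable_uncurry_path hm hc).comp
        (measurable_fst.prodMk (measurable_real_toNNReal.comp measurable_snd))).const_add 0)
    exact (StronglyMeasurable.integral_prod_right
      (ν := volume.restrict (Set.Ioc 0 ((i.1 : ℝ) / 4 ^ n))) h1.stronglyMeasurable).measurable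
  have hYb : ∀ n i ω, |Y n i ω| ≤ (i.1 : ℝ) / 4 ^ n := fun n i ω => by
    refine (norm_setIntegral_le_of_norm_le_const (C := 1) measure_Ioc_lt_top
      (fun s _ => (Real.norm_eq_abs _).trans_le (abs_dipole_le _ _ _))).trans ?_
    rw [Real.volume_real_Ioc_of_le (by positivity)]
    simp
  have hYint : ∀ n i, Integrable (fun ω => Y n i ω ^ (2 * 10)) P := fun n i =>
    Integrable.of_bound ((hYm n i).pow_const _).aestronglyMeasurable (((i.1 : ℝ) / 4 ^ n) ^ (2 * 10))
      (ae_of_all _ fun ω => by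
        rw [norm_pow, Real.norm_eq_abs]
        exact pow_le_pow_left₀ (abs_nonneg _) (hYb n i ω) _)
  have hh : ∀ n : ℕ, (((1 : ℝ) / 2 ^ n) ^ 2 * √(1 / 2 ^ n)) ^ 10 = ((1 / 2) ^ 25) ^ n := fun n => by
    have h1 : √((1 : ℝ) / 2 ^ n) ^ 2 = 1 / 2 ^ n := Real.sq_sqrt (by positivity)
    calc _ = ((1 : ℝ) / 2 ^ n) ^ 20 * (√(1 / 2 ^ n) ^ 2) ^ 5 := by ring
      _ = (((1 : ℝ) / 2) ^ n) ^ 25 := by rw [h1, ← one_div_pow, ← pow_add]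
      _ = _ := by rw [← pow_mul, ← pow_mul, mul_comm]
  have hYE : ∀ n, ∀ i ∈ I n, ∫ ω, Y n i ω ^ (2 * 10) ∂P ≤ c * ((1 / 2) ^ 25) ^ n := fun n i hi => by
    rw [integral_occupation_pow_eq hB hm hc (measurable_dipole _ _) (abs_dipole_le _ _) (2 * 10)
      (by positivity) 0, ← hh]
    refine (le_abs_self _).trans ((hcb _ _ (by positivity) _ (by positivity) ?_).1 0)
    rw [hI, Finset.mem_product, Finset.mem_range] at hi
    rw [div_le_iff₀ (by positivity)]
    exact_mod_cast Nat.lt_succ_iff.1 hi.1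
  have hcard : ∀ n, ((I n).card : ℝ) ≤ 6 * N ^ 2 * 8 ^ n := fun n => by
    have h1 : (1 : ℝ) ≤ 4 ^ n := one_le_pow₀ (by norm_num)
    have h2 : (1 : ℝ) ≤ 2 ^ n := one_le_pow₀ (by norm_num)
    have e : (Finset.Icc (-(N * 2 ^ n : ℤ)) (N * 2 ^ n)).card = 2 * (N * 2 ^ n) + 1 := by
      rw [Int.card_Icc]
      have : (N * 2 ^ n : ℤ) = ((N * 2 ^ n : ℕ) : ℤ) := by push_cast; rfl
      rw [this]
      omega
    rw [hI, Finset.card_product, Finset.card_range, e]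
    push_cast
    have h3 : 1 ≤ (N : ℝ) * 4 ^ n := one_le_mul_of_one_le_of_one_le hN' h1
    have h4 : 1 ≤ (N : ℝ) * 2 ^ n := one_le_mul_of_one_le_of_one_le hN' h2
    calc _ ≤ (2 * ((N : ℝ) * 4 ^ n)) * (3 * (N * 2 ^ n)) := by
          gcongr <;> linarith
      _ = _ := by
          rw [show (8 : ℝ) = 4 * 2 by norm_num, mul_pow]; ring
  have hsum : Summable fun n => (I n).card * (c * ((1 / 2 : ℝ) ^ 25) ^ n) /
      ((19 / 20 / 2 : ℝ) ^ n) ^ (2 * 10) := by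
    refine Summable.of_nonneg_of_le (fun n => by positivity) (fun n => ?_)
      ((summable_geometric_of_lt_one (r := 8 * (1 / 2) ^ 25 / (19 / 20 / 2) ^ 20) (by norm_num)
        (by norm_num)).mul_left (6 * N ^ 2 * c))
    calc _ ≤ (6 * N ^ 2 * 8 ^ n) * (c * ((1 / 2 : ℝ) ^ 25) ^ n) /
          ((19 / 20 / 2 : ℝ) ^ n) ^ (2 * 10) := by
          gcongr
          exact hcard n
      _ = _ := by
          have e : ∀ A x y : ℝ, A * 8 ^ n * (c * x ^ n) / (y ^ n) ^ (2 * 10) =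
              A * c * (8 * x / y ^ 20) ^ n := fun A x y => by
            rw [div_pow (8 * x), mul_pow 8 x, pow_right_comm y]
            ring
          exact e _ _ _
  filter_upwards [ae_exists_forall_abs_le (M := 10) (by norm_num) hYint hYE
    (fun n => by positivity) hsum] with ω ⟨C, hC⟩
  refine ⟨C, fun n j hj k hk => ?_⟩
  rw [← hYo n (j, k) ω]
  refine hC n (j, k) ?_
  rw [hI, Finset.mem_product, Finset.mem_range, Finset.mem_Icc]
  exact ⟨Nat.lt_succ_iff.2 hj, abs_le.1 hk⟩

/-- Almost surely, the occupation of neighbouring dyadic intervals by Brownian motion differs by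
little, uniformly on compact time intervals. -/
theorem ae_forall_exists_dyadic_bound (hB : IsPreBrownianReal B P) (hm : ∀ t, Measurable (B t))
    (hc : ∀ ω, Continuous (B · ω)) :
    ∀ᵐ ω ∂P, ∀ T : ℝ, ∃ C : ℝ, ∀ t, 0 ≤ t → t ≤ T → ∀ (n : ℕ) (k : ℤ),
      |(occupation (fun t => B t.toNNReal ω) 0 t).real (dyadicIco n k) -
        (occupation (fun t => B t.toNNReal ω) 0 t).real (dyadicIco n (k + 1))| ≤
        C * (19 / 20 / 2) ^ n := by
  filter_upwards [ae_all_iff.2 fun N : ℕ =>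
    ae_exists_grid_bound hB hm hc (Nat.le_add_left 1 N)] with ω hω T
  set u : ℝ → ℝ := fun t => B t.toNNReal ω with hu_def
  have huc : Continuous u := (hc ω).comp continuous_real_toNNReal
  have hu := huc.measurable
  obtain ⟨R, hR⟩ := (isCompact_Icc (a := (0 : ℝ)) (b := T)).exists_bound_of_continuousOn
    huc.continuousOn
  obtain ⟨N, hN⟩ := exists_nat_ge (max T (R + 1))
  have hNT : T ≤ N := (le_max_left _ _).trans hN
  have hNR : R + 1 ≤ N := (le_max_right _ _).trans hN
  -- This is the grid bound with `N + 1 ≥ R + 2`. The margin makes both intervals `k` and `k + 1`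
  -- miss `[-R, R]` when `k` is out of range.
  obtain ⟨C, hC⟩ := hω N
  have hC0 : 0 ≤ C := by
    have := (abs_nonneg _).trans (hC 0 0 (Nat.zero_le _) 0 (by positivity))
    simpa using this
  refine ⟨C + 1, fun t ht htT n k => ?_⟩
  have hR' : ∀ s, 0 ≤ s → s ≤ t → |u s| ≤ R := fun s h1 h2 => hR s ⟨h1, h2.trans htT⟩
  have h2n : (1 : ℝ) ≤ 2 ^ n := one_le_pow₀ (by norm_num)
  by_cases hk : |k| ≤ (N + 1 : ℕ) * 2 ^ n
  -- Rounding `t` down to the grid lowers each of the two masses by at most `4⁻ⁿ ≤ (19/40) ^ n`,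
  -- whence `C + 1`.
  · set j := ⌊t * 4 ^ n⌋₊
    have h4 : (0 : ℝ) < 4 ^ n := by positivity
    have hj1 : (j : ℝ) / 4 ^ n ≤ t := by
      rw [div_le_iff₀ h4]
      exact Nat.floor_le (by positivity)
    have hj2 : t - (j : ℝ) / 4 ^ n ≤ (19 / 20 / 2) ^ n := by
      have h5 : t - (j : ℝ) / 4 ^ n ≤ 1 / 4 ^ n := by
        rw [sub_le_iff_le_add, ← add_div, le_div_iff₀ h4, add_comm]
        exact (Nat.lt_floor_add_one _).le
      refine h5.trans ?_
      rw [← one_div_pow]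
      exact pow_le_pow_left₀ (by norm_num) (by norm_num) n
    have hj : j ≤ (N + 1) * 4 ^ n := by
      have : (j : ℝ) ≤ (N + 1) * 4 ^ n :=
        ((div_le_iff₀ h4).1 hj1).trans (by gcongr; linarith)
      exact_mod_cast this
    have h6 := abs_le.1 (hC n j hj k hk)
    have h7 := occupation_increment_le hu (by positivity) hj1 (measurableSet_dyadicIco n k)
    have h8 := occupation_increment_le hu (by positivity) hj1 (measurableSet_dyadicIco n (k + 1))
    rw [abs_le]
    constructor <;> nlinarith [h6.1, h6.2, h7.1, h7.2, h8.1, h8.2]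
  · have hk' : ((N + 1 : ℕ) : ℝ) * 2 ^ n < |(k : ℝ)| := by
      rw [not_le] at hk
      exact_mod_cast hk
    push_cast at hk'
    have h2n' : (0 : ℝ) < 2 ^ n := by positivity
    have hz : (occupation u 0 t).real (dyadicIco n k) = 0 ∧
        (occupation u 0 t).real (dyadicIco n (k + 1)) = 0 := by
      have hNN : (R + 2) * 2 ^ n ≤ ((N : ℝ) + 1) * 2 ^ n :=
        mul_le_mul_of_nonneg_right (by linarith) h2n'.le
      rcases lt_abs.1 hk' with h | h
      · exact ⟨occupation_real_eq_zero hu hR' (Or.inl (by rw [lt_div_iff₀ h2n']; nlinarith)),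
          occupation_real_eq_zero hu hR' (Or.inl (by
            push_cast; rw [lt_div_iff₀ h2n']; nlinarith))⟩
      · exact ⟨occupation_real_eq_zero hu hR' (Or.inr (by rw [div_lt_iff₀ h2n']; nlinarith)),
          occupation_real_eq_zero hu hR' (Or.inr (by
            push_cast; rw [div_lt_iff₀ h2n']; nlinarith))⟩
    rw [hz.1, hz.2, sub_zero, abs_zero]
    positivity

end DyadicBound

/-! ### The theorem -/

theorem theorem2 {Ω : Type*} [MeasurableSpace Ω] (P : Measure Ω) [IsProbabilityMeasure P]
    (W : ℝ≥0 → Ω → ℝ) (hW : IsBrownianReal W P)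
    (ζ : Ω → ℝ) (hζ : HasLaw ζ (expMeasure (1 / 2)) P)
    (hind : IndepFun (fun ω t => W t ω) ζ P)
    (f : ℝ → ℝ) (hf : ContDiff ℝ (⊤ : ℕ∞) f) (hf_nonneg : ∀ y, 0 ≤ f y)
    (hf_supp : Function.support f ⊆ Set.Icc (-1) 1) (hf_int : ∫ y, f y = 1)
    (m : ℕ) :
    ∀ᵐ ω ∂P,
      (∀ K : Set (Fin m → ℝ), IsCompact K →
        TendstoUniformlyOn
          (fun ε x => IntersectionLocalTime.approx f (fun t => W t ω) (ζ ω) ε x)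
          (fun x => IntersectionLocalTime.limit f (fun t => W t ω) (ζ ω) x) (𝓝[>] (0 : ℝ)) K) ∧
      Continuous (fun x : Fin m → ℝ =>
        IntersectionLocalTime.limit f (fun t => W t ω) (ζ ω) x) ∧
      ∀ Φ : (Fin m → ℝ) → ℝ, Measurable Φ → (∃ C : ℝ, ∀ x, |Φ x| ≤ C) →
        Integrable (fun x : Fin m → ℝ =>
          Φ x * IntersectionLocalTime.limit f (fun t => W t ω) (ζ ω) x) ∧
        IntegrableOn (fun t => Φ (IntersectionLocalTime.increments (fun s => W s ω) t))
          (IntersectionLocalTime.orderedTimes m (ζ ω)) ∧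
        ∫ x : Fin m → ℝ, Φ x * IntersectionLocalTime.limit f (fun t => W t ω) (ζ ω) x =
          ∫ t in IntersectionLocalTime.orderedTimes m (ζ ω),
            Φ (IntersectionLocalTime.increments (fun s => W s ω) t) := by
  obtain ⟨B, hBm, hBc, hWB⟩ := exists_measurable_continuous_modification
    (fun t => hW.toIsPreBrownianReal.aemeasurable t) hW.cont
  have hB : IsPreBrownianReal B P := hW.toIsPreBrownianReal.congr fun t => hWB.mono fun ω h => h t
  filter_upwards [hWB, ae_forall_exists_dyadic_bound hB hBm hBc] with ω h1 h2
  have hpath : (fun t => W t ω) = fun t => B t ω := funext h1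
  rw [hpath]
  -- The exceptional null set does not depend on `T`, so the random time can be inserted path by
  -- path.
  obtain ⟨C, hC⟩ := h2 (ζ ω)
  obtain ⟨G, hG, hG0, hGc, h⟩ := IntersectionLocalTime.exists_density_of_dyadic_bound (hBc ω)
    (by norm_num) (by norm_num) hC m
  exact IntersectionLocalTime.limit_of_density hf.continuous hf_nonneg hf_supp hf_int
    (hBc ω).measurable hG hG0 hGc h
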